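/- **Representer theorem for direct-product spaces.** *Conventions.* All spaces are real. For a normed space $X$ with dual $X'$, the duality mapping is $J_X(\nu)=\{f\in X' : \|f\|=\|\nu\|,\ \langle f,\nu\rangle=\|\nu\|\,\|f\|\}$; elements of $J_X(\nu)$ are called Banach conjugates of $\nu$. When $J_X$ is single-valued, $\mathrm J_X\{\nu\}$ denotes its unique value. $\mathrm{Ext}(C)$ is the set of extreme points of $C$, and $B_{X'}$ is the closed unit ball of $X'$. *Setting.* Let $X_1,\dots,X_N$ be Banach spaces and let $Z=(\mathbb R^N,\|\cdot\|_Z)$ with an absolute norm, i.e. $\|(|z_n|)\|_Z=\|z\|_Z$, with dual norm $\|\cdot\|_{Z'}$. Let $X=(X_1\times\dots\times X_N)_Z$ be the product with norm $\|(\|x_1\|,\dots,\|x_N\|)\|_Z$. Its dual is $X'=(X_1'\times\dots\times X_N')_{Z'}$, under $\langle f,x\rangle=\sum_n\langle f_n,x_n\rangle$. Let $\nu_1,\dots,\nu_M\in X$ be linearly independent, $\nu_m=(\nu_{m,1},\dots,\nu_{m,N})$, and put $\boldsymbol\nu(f)=(\langle\nu_1,f\rangle,\dots,\langle\nu_M,f\rangle)$.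 Let $E:\mathbb R^M\times\mathbb R^M\to[0,\infty]$ and fix $\boldsymbol y\in\mathbb R^M$ such that $E(\boldsymbol y,\cdot)$ is proper, lower semicontinuous and strictly convex on its effective domain. Let $\psi:[0,\infty)\to[0,\infty)$ be strictly increasing and strictly convex. Let $$S=\arg\min_{f\in X'}\big(E(\boldsymbol y,\boldsymbol\nu(f))+\psi(\|f\|_{X'})\big),$$ and let $S|_n=\{f_n: f\in S\}\subset X_n'$. *Conclusions.* $S$ is nonempty, convex and weak\*-compact. There are $a\in\mathbb R^M$ and $y^*\in\mathbb R^N$ such that every $f_0=(f_{0,1},\dots,f_{0,N})\in S$ is a Banach conjugate of $\nu_0=\sum_{m}a_m\nu_m$ and, with $y=(\|f_{0,1}\|,\dots,\|f_{0,N}\|)\in Z'$, the vector $y^*\in Z''=Z$ is a Banach conjugate of $y$. Put $\alpha_n=y_n/y_n^*$ if $y_n\ne0$ and $\alpha_n=0$ otherwise. 1. Suppose $Z'$ is strictly convex. Then, for every $f_0\in S$, $\alpha_n>0$ whenever $y_n\neq 0$, and: - if $X_n'$ is a Hilbert space, then $f_{0,n}$ is unique ($S|_n$ is a single point) and $f_{0,n}=\alpha_n\sum_m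 a_m\varphi_{m,n}$ with $\varphi_{m,n}=\mathrm J_{X_n}\{\nu_{m,n}\}$, where $\mathrm J_{X_n}$ is the Riesz map $X_n\to X_n'$; - if $X_n'$ is strictly convex, then $f_{0,n}$ is unique and $f_{0,n}=\alpha_n\,\mathrm J_{X_n}\{\sum_m a_m\nu_{m,n}\}$. 2. For every $n$ (in particular when $X_n'$ is not strictly convex), $S|_n$ is the weak\*-closure of the convex hull of its extreme points, and each of these is the $n$-th component of some $f_0\in\mathrm{Ext}(S)$. For every $f_0\in\mathrm{Ext}(S)$ let $K_0$ be the minimal number of points of $\mathrm{Ext}(B_{X'})$ of which $f_0$ is a linear combination. Then $K_0$ exists, $K_0\le M$, and for every $n$ one has $f_{0,n}=\sum_{k=1}^{K_0}c_{k,n}e_{k,n}$ with $c_{k,n}\in\mathbb R$ and $e_{k,n}\in\mathrm{Ext}(B_{X_n'})$. 3. Suppose $\|\cdot\|_{Z'}=\|\cdot\|_1$. Then for every $f_0\in\mathrm{Ext}(S)$ there are $K_1,\dots,K_N\ge 0$ with $\sum_nK_n\le M$ and $f_{0,n}=\sum_{k=1}^{K_n}c_{k,n}e_{k,n}$, where $c_{k,n}\in\mathbb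 R$ and $e_{k,n}\in\mathrm{Ext}(B_{X_n'})$; here, for each $n$ with $X_n'$ strictly convex and $f_{0,n}\ne0$, one has $K_n=1$, $c_{1,n}=\|f_{0,n}\|$ and $e_{1,n}=f_{0,n}/\|f_{0,n}\|$. Moreover, for every $f_0\in S$, $\alpha_n>0$ whenever $y_n\ne0$, and the formulas for $f_{0,n}$ in item 1 remain valid for Hilbert, respectively strictly convex, $X_n'$ (without uniqueness). -/

import Mathlib

open scoped NNReal ENNReal

/-! ### Duality mapping of a real normed space -/

/-- The duality mapping `J(x)`: all `f` in the dual with `‖f‖ = ‖x‖` and `⟨x, f⟩ = ‖x‖ ‖f‖`. -/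
def dualityMap {X : Type*} [NormedAddCommGroup X] [NormedSpace ℝ X] (x : X) :
    Set (StrongDual ℝ X) :=
  {f | ‖f‖ = ‖x‖ ∧ f x = ‖x‖ * ‖f‖}

/-- The duality mapping is single-valued and `J` is the resulting duality operator. -/
def IsDualityOperator {X : Type*} [NormedAddCommGroup X] [NormedSpace ℝ X]
    (J : X → StrongDual ℝ X) : Prop :=
  ∀ x, dualityMap x = {J x}

/-- The norm is induced by an inner product (together with completeness: a Hilbert space). -/
def HasHilbertNorm (H : Type*) [NormedAddCommGroup H] [NormedSpace ℝ H] : Prop :=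
  ∃ B : H →ₗ[ℝ] H →ₗ[ℝ] ℝ, (∀ x y, B x y = B y x) ∧ ∀ x, B x x = ‖x‖ ^ 2

/-- `R` is the Riesz map: `(x, y) ↦ R x y` is the inner product that induces the norm. -/
def IsRieszMap {X : Type*} [NormedAddCommGroup X] [NormedSpace ℝ X]
    (R : X →L[ℝ] StrongDual ℝ X) : Prop :=
  (∀ x y, R x y = R y x) ∧ ∀ x, R x x = ‖x‖ ^ 2

/-! ### Absolute norms on `ℝ^N` -/

/-- A norm on `ℝ^N` that depends only on the absolute values of the coordinates. -/
structure AbsoluteNorm (N : ℕ) extends Seminorm ℝ (Fin N → ℝ) where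
  definite : ∀ z, toFun z = 0 → z = 0
  absolute : ∀ z, toFun (fun n => |z n|) = toFun z

namespace AbsoluteNorm

variable {N : ℕ}

instance : CoeFun (AbsoluteNorm N) (fun _ => (Fin N → ℝ) → ℝ) := ⟨fun ρ => ρ.toSeminorm⟩

/-- The dual norm `‖y‖_{Z'} = sup { ∑ y_n z_n : ‖z‖_Z ≤ 1 }`. -/
noncomputable def dualNorm (ρ : AbsoluteNorm N) (y : Fin N → ℝ) : ℝ :=
  sSup {r | ∃ z : Fin N → ℝ, ρ z ≤ 1 ∧ r = ∑ n, y n * z n}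

/-- The duality mapping `J_{Z'}` from `Z'` to subsets of `Z'' = Z`. -/
def dualDualityMap (ρ : AbsoluteNorm N) (y : Fin N → ℝ) : Set (Fin N → ℝ) :=
  {z | ρ z = ρ.dualNorm y ∧ ∑ n, y n * z n = ρ.dualNorm y * ρ z}

/-- Strict convexity of the dual norm `‖·‖_{Z'}`. -/
def DualStrictConvex (ρ : AbsoluteNorm N) : Prop :=
  ∀ u v : Fin N → ℝ, ρ.dualNorm u = 1 → ρ.dualNorm v = 1 → u ≠ v →
    ∀ t : ℝ, 0 < t → t < 1 → ρ.dualNorm (t • u + (1 - t) • v) < 1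

/-- The dual norm `‖·‖_{Z'}` is the `ℓ¹` norm. -/
def DualIsL1 (ρ : AbsoluteNorm N) : Prop :=
  ∀ y : Fin N → ℝ, ρ.dualNorm y = ∑ n, |y n|

theorem update_le (ρ : AbsoluteNorm N) (z : Fin N → ℝ) (i : Fin N) (s : ℝ) (hs : |s| ≤ |z i|) :
    ρ (Function.update z i s) ≤ ρ z := by
  classical
  rcases eq_or_ne (z i) 0 with h0 | h0
  · have hs0 : s = z i := by
      rw [h0] at hs ⊢
      simpa using hs
    rw [hs0, Function.update_eq_self]
  · have hneg : ρ (Function.update z i (-(z i))) = ρ z := by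
      have habs : ∀ w : Fin N → ℝ, ρ (fun n => |w n|) = ρ w := ρ.absolute
      rw [← habs (Function.update z i (-(z i))), ← habs z]
      have : (fun n => |Function.update z i (-(z i)) n|) = fun n => |z n| := by
        funext n
        rcases eq_or_ne n i with rfl | hn
        · simp
        · simp [hn]
      rw [this]
    set t : ℝ := (1 + s / z i) / 2 with ht
    have hq : |s / z i| ≤ 1 := by
      rw [abs_div]
      exact div_le_one_of_le₀ hs (abs_nonneg _)
    have hq' := abs_le.mp hq
    have ht0 : 0 ≤ t := by rw [ht]; linarith
    have ht1 : 0 ≤ 1 - t := by rw [ht]; linarith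
    have hdec : Function.update z i s = t • z + (1 - t) • Function.update z i (-(z i)) := by
      funext n
      rcases eq_or_ne n i with rfl | hn
      · simp only [Function.update_self, Pi.add_apply, Pi.smul_apply, smul_eq_mul, ht]
        field_simp
        ring
      · simp only [Function.update_of_ne hn, Pi.add_apply, Pi.smul_apply, smul_eq_mul]
        ring
    calc ρ (Function.update z i s)
        = ρ (t • z + (1 - t) • Function.update z i (-(z i))) := by rw [hdec]
      _ ≤ ρ (t • z) + ρ ((1 - t) • Function.update z i (-(z i))) := map_add_le_add ρ.toSeminorm _ _
      _ = t * ρ z + (1 - t) * ρ z := by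
          rw [map_smul_eq_mul, map_smul_eq_mul, hneg, Real.norm_of_nonneg ht0,
            Real.norm_of_nonneg ht1]
      _ = ρ z := by ring

/-- An absolute norm is monotone. -/
theorem mono (ρ : AbsoluteNorm N) (u v : Fin N → ℝ) (h : ∀ n, |u n| ≤ |v n|) : ρ u ≤ ρ v := by
  classical
  have key : ∀ s : Finset (Fin N), ρ (fun n => if n ∈ s then u n else v n) ≤ ρ v := by
    intro s
    induction s using Finset.induction_on with
    | empty => simp
    | insert i s hi ih =>
      refine le_trans ?_ ih
      have : (fun n => if n ∈ insert i s then u n else v n)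
          = Function.update (fun n => if n ∈ s then u n else v n) i (u i) := by
        funext n
        rcases eq_or_ne n i with rfl | hn
        · simp
        · simp [hn]
      rw [this]
      apply ρ.update_le
      simpa [hi] using h i
  simpa using key Finset.univ

end AbsoluteNorm

/-! ### Direct products with a composite norm -/

/-- The direct product `(X_1 × ⋯ × X_N)_Z`, where `Z` is `ℝ^N` with the absolute norm `ρ`. -/
def DirectProd {N : ℕ} (_ρ : AbsoluteNorm N) (X : Fin N → Type*) := ∀ n, X n

namespace DirectProd

variable {N : ℕ} {ρ : AbsoluteNorm N} {X : Fin N → Type*}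
  [∀ n, NormedAddCommGroup (X n)]

instance : AddCommGroup (DirectProd ρ X) := inferInstanceAs (AddCommGroup (∀ n, X n))

instance [∀ n, NormedSpace ℝ (X n)] : Module ℝ (DirectProd ρ X) := inferInstanceAs (Module ℝ (∀ n, X n))

/-- The composite norm `‖(‖x_1‖, …, ‖x_N‖)‖_Z`. -/
noncomputable def compositeNorm (ρ : AbsoluteNorm N) (X : Fin N → Type*)
    [∀ n, NormedAddCommGroup (X n)] : AddGroupNorm (∀ n, X n) where
  toFun x := ρ (fun n => ‖x n‖)
  map_zero' := by
    have : (fun n => ‖(0 : ∀ n, X n) n‖) = (0 : Fin N → ℝ) := by funext n; simp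
    rw [this]
    exact map_zero ρ.toSeminorm
  add_le' x y := by
    refine le_trans (ρ.mono _ ((fun n => ‖x n‖) + fun n => ‖y n‖) fun n => ?_)
      (map_add_le_add ρ.toSeminorm _ _)
    rw [abs_of_nonneg (norm_nonneg _)]
    exact (norm_add_le _ _).trans (le_abs_self _)
  neg' x := by simp
  eq_zero_of_map_eq_zero' x hx := by
    have h := ρ.definite _ hx
    funext n
    simpa using congrFun h n

noncomputable instance : NormedAddCommGroup (DirectProd ρ X) :=
  AddGroupNorm.toNormedAddCommGroup (compositeNorm ρ X)

theorem norm_def (x : DirectProd ρ X) : ‖x‖ = ρ (fun n => ‖x n‖) := rfl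

variable [∀ n, NormedSpace ℝ (X n)]

noncomputable instance : NormedSpace ℝ (DirectProd ρ X) where
  norm_smul_le c x := by
    have h : (fun n => ‖(c • x) n‖) = ‖c‖ • fun n => ‖x n‖ := by
      funext n
      exact norm_smul c (x n)
    rw [norm_def, norm_def, h, map_smul_eq_mul, norm_norm]

/-- The inclusion of the `n`-th factor. -/
noncomputable def single (ρ : AbsoluteNorm N) (X : Fin N → Type*)
    [∀ n, NormedAddCommGroup (X n)] [∀ n, NormedSpace ℝ (X n)] (n : Fin N) :
    X n →L[ℝ] DirectProd ρ X :=
  LinearMap.mkContinuous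
    { toFun := fun x => (Pi.single n x : ∀ k, X k)
      map_add' := fun x y => Pi.single_add n x y
      map_smul' := fun c x => Pi.single_smul n c x }
    (ρ (Pi.single n 1)) (fun x => by
      have h : (fun k => ‖(Pi.single n x : ∀ k, X k) k‖) = ‖x‖ • (Pi.single n 1 : Fin N → ℝ) := by
        funext k
        rcases eq_or_ne k n with rfl | hk
        · simp
        · simp [hk]
      change ρ (fun k => ‖(Pi.single n x : ∀ k, X k) k‖) ≤ _
      rw [h, map_smul_eq_mul, norm_norm, mul_comm])

/-- The `n`-th component `f_n ∈ X_n'` of `f ∈ X'`, so that `⟨f, x⟩ = ∑ ⟨f_n, x_n⟩`. -/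
noncomputable def component (n : Fin N) (f : StrongDual ℝ (DirectProd ρ X)) :
    StrongDual ℝ (X n) :=
  f.comp (single ρ X n)

/-- The vector `(‖f_1‖, …, ‖f_N‖)` of component norms. -/
noncomputable def componentNorms (f : StrongDual ℝ (DirectProd ρ X)) : Fin N → ℝ :=
  fun n => ‖component n f‖

end DirectProd

/-! ### The optimization problem -/

/-- Strict convexity of an extended-valued function on its effective domain. Since the values are
in `[0, ∞]`, this includes convexity. -/
def EStrictConvex {M : ℕ} (F : (Fin M → ℝ) → ℝ≥0∞) : Prop :=
  ∀ u v : Fin M → ℝ, u ≠ v → F u ≠ ∞ → F v ≠ ∞ → ∀ t : ℝ, 0 < t → t < 1 →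
    F (t • u + (1 - t) • v) < ENNReal.ofReal t * F u + ENNReal.ofReal (1 - t) * F v

/-- The functional `f ↦ E(y, ν(f)) + ψ(‖f‖)` on the dual of `X`. -/
noncomputable def objective {M : ℕ} {X : Type*} [NormedAddCommGroup X] [NormedSpace ℝ X]
    (E : (Fin M → ℝ) → (Fin M → ℝ) → ℝ≥0∞) (y : Fin M → ℝ) (ν : Fin M → X) (ψ : ℝ≥0 → ℝ≥0)
    (f : StrongDual ℝ X) : ℝ≥0∞ :=
  E y (fun m => f (ν m)) + (ψ ‖f‖₊ : ℝ≥0∞)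

/-- The set of minimizers over the dual of `X`. -/
def solutionSet {M : ℕ} {X : Type*} [NormedAddCommGroup X] [NormedSpace ℝ X]
    (E : (Fin M → ℝ) → (Fin M → ℝ) → ℝ≥0∞) (y : Fin M → ℝ) (ν : Fin M → X) (ψ : ℝ≥0 → ℝ≥0) :
    Set (StrongDual ℝ X) :=
  {f | ∀ g, objective E y ν ψ f ≤ objective E y ν ψ g}

/-- The scaling constants `α_n = y_n / y*_n` if `y_n ≠ 0`, and `0` otherwise. -/
noncomputable def scaling {N : ℕ} (y ystar : Fin N → ℝ) (n : Fin N) : ℝ :=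
  open Classical in if y n = 0 then 0 else y n / ystar n

/-- The extremal points of the closed unit ball of the dual of `X`. -/
def dualAtoms (X : Type*) [NormedAddCommGroup X] [NormedSpace ℝ X] : Set (StrongDual ℝ X) :=
  Set.extremePoints ℝ (Metric.closedBall (0 : StrongDual ℝ X) 1)

/-- `f` is a linear combination of `K` extremal points of the unit ball of the dual of `X`. -/
def IsAtomicSum {X : Type*} [NormedAddCommGroup X] [NormedSpace ℝ X] (K : ℕ)
    (f : StrongDual ℝ X) : Prop :=
  ∃ (c : Fin K → ℝ) (e : Fin K → StrongDual ℝ X), (∀ k, e k ∈ dualAtoms X) ∧ f = ∑ k, c k • e k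

/-- The image of a subset of the dual in the dual with its weak* topology. -/
def weakStar {X : Type*} [NormedAddCommGroup X] [NormedSpace ℝ X] (A : Set (StrongDual ℝ X)) :
    Set (WeakDual ℝ X) :=
  StrongDual.toWeakDual '' A

/-! ### Existence and structure of the solution set -/

section Optimization

variable {M : ℕ} {X : Type*} [NormedAddCommGroup X] [NormedSpace ℝ X]

/-! Existence is the direct method: Banach–Alaoglu gives weak* compact balls, and `ψ` is unbounded.
At the midpoint of two solutions, strict convexity of `E y` forces equal data `z`, and then strict
convexity of `ψ` forces equal norms `r`. Hence the solution set is the set of `f` with `f (ν m) = z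
m` and `‖f‖ ≤ r`, which is convex and weak* compact. The data define a functional on the
finite-dimensional span of the `ν m`; it attains its norm there, and Hahn–Banach extends it with
that norm. A rescaled maximizer `ν₀ = ∑ a m • ν m` then has norm `r`, and every solution pairs with
it to `∑ a m * z m = r * r`. So all solutions are conjugates of this one vector
(`exists_solutionSet_eq`).

In the product, `‖f‖ ‖ν₀‖ = ∑ ⟨f_n, ν₀_n⟩ ≤ ∑ ‖f_n‖ ‖ν₀_n‖ ≤ ‖f‖ ‖ν₀‖`, with equality throughout.
The last equality says that `y* = (‖ν₀_n‖)` is conjugate to the component norms; the first, that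
each nonzero `f_n` is a multiple of a conjugate of `ν₀_n`, unless `ν₀_n = 0`
(`conjugate_component`). The exception is excluded by `ne_zero_of_conjugate` when the dual outer
norm is strictly convex or `ℓ¹`.

For extreme solutions, the ball of radius `r` is replaced by its exposed face `C = {g ν₀ = r * r}`.
The solution set is cut out of `C` by `M` equations, one of them redundant because `ν₀` lies in the
span. An extreme solution therefore lies in a face of `C` of dimension at most `M - 1`, and
Minkowski–Carathéodory writes it with at most `M` atoms. Components of atoms are multiples of atoms;
for `ℓ¹` each atom has at most one nonzero component, so the `M` atoms are shared out among the
factors. -/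

theorem lowerSemicontinuous_nnnorm_weakDual :
    LowerSemicontinuous (fun f : WeakDual ℝ X => ‖WeakDual.toStrongDual f‖₊) := by
  rw [lowerSemicontinuous_iff_isClosed_preimage]
  intro r
  have h := WeakDual.isClosed_closedBall (𝕜 := ℝ) (0 : StrongDual ℝ X) (r : ℝ)
  convert h using 1
  ext f
  simp [← NNReal.coe_le_coe]

/-- A strictly increasing convex function on `[0, ∞)` is continuous. -/
theorem continuous_of_strictMono_of_convexOn {ψ : ℝ≥0 → ℝ≥0} (hmono : StrictMono ψ)
    (hconv : ConvexOn ℝ≥0 Set.univ ψ) : Continuous ψ := by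
  -- Extending `ψ` to negative reals by the constant `ψ 0` keeps it convex, by monotonicity, and
  -- makes the endpoint `0` an interior point.
  have hc : ConvexOn ℝ Set.univ (fun t : ℝ => (ψ t.toNNReal : ℝ)) := by
    refine ⟨convex_univ, fun x _ y _ a b ha hb hab => ?_⟩
    have h1 : (a • x + b • y).toNNReal ≤
        a.toNNReal • x.toNNReal + b.toNNReal • y.toNNReal := by
      rw [Real.toNNReal_le_iff_le_coe]
      push_cast [smul_eq_mul, Real.coe_toNNReal _ ha, Real.coe_toNNReal _ hb]
      exact add_le_add (mul_le_mul_of_nonneg_left (Real.le_coe_toNNReal x) ha)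
        (mul_le_mul_of_nonneg_left (Real.le_coe_toNNReal y) hb)
    have h2 := hconv.2 (Set.mem_univ x.toNNReal) (Set.mem_univ y.toNNReal)
      zero_le zero_le
      (by rw [← Real.toNNReal_add ha hb, hab, Real.toNNReal_one])
    have h3 := NNReal.coe_le_coe.2 ((hmono.monotone h1).trans h2)
    push_cast [smul_eq_mul, Real.coe_toNNReal _ ha, Real.coe_toNNReal _ hb] at h3
    simpa [smul_eq_mul] using h3
  have hcont : Continuous (fun t : ℝ => (ψ t.toNNReal : ℝ)) := by
    have := hc.continuousOn_interior
    rwa [interior_univ, continuousOn_univ] at this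
  have : Continuous (fun t : ℝ≥0 => ((ψ t : ℝ≥0) : ℝ)) := by
    have := hcont.comp NNReal.continuous_coe
    simpa [Function.comp_def] using this
  exact NNReal.isEmbedding_coe.continuous_iff.2 this

/-- A strictly increasing convex function on `[0, ∞)` is unbounded. -/
theorem exists_lt_of_strictMono_of_convexOn {ψ : ℝ≥0 → ℝ≥0} (hmono : StrictMono ψ)
    (hconv : ConvexOn ℝ≥0 Set.univ ψ) (c : ℝ≥0) : ∃ R, c < ψ R := by
  have h01 : (ψ 0 : ℝ) < ψ 1 := NNReal.coe_lt_coe.2 (hmono zero_lt_one)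
  set δ : ℝ := ψ 1 - ψ 0 with hδ
  have hδ0 : 0 < δ := sub_pos.2 h01
  obtain ⟨k, hk⟩ := exists_nat_gt ((c : ℝ) / δ)
  refine ⟨(k : ℝ≥0) + 1, ?_⟩
  have hK : (0 : ℝ) < (k : ℝ) + 1 := by positivity
  have hsum : (k : ℝ≥0) / (k + 1) + 1 / (k + 1) = 1 := by
    rw [← add_div, div_self]; positivity
  -- Convexity at `1`, between `0` and `k + 1`, gives the linear growth `ψ (k + 1) ≥ ψ 1 + k * δ`.
  have h := hconv.2 (Set.mem_univ 0) (Set.mem_univ ((k : ℝ≥0) + 1))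
    zero_le zero_le hsum
  have h1 : ((k : ℝ≥0) / (k + 1)) • (0 : ℝ≥0) + (1 / ((k : ℝ≥0) + 1)) • ((k : ℝ≥0) + 1) = 1 := by
    rw [smul_zero, zero_add, smul_eq_mul, one_div, inv_mul_cancel₀]; positivity
  rw [h1] at h
  have h' := NNReal.coe_le_coe.2 h
  push_cast [smul_eq_mul] at h'
  rw [← NNReal.coe_lt_coe]
  have h2 : ((k : ℝ) + 1) * ψ 1 ≤ k * ψ 0 + ψ ((k : ℝ≥0) + 1) := by
    have := mul_le_mul_of_nonneg_left h' hK.le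
    refine this.trans (le_of_eq ?_)
    field_simp
  have h3 : (c : ℝ) < k * δ := by rwa [div_lt_iff₀ hδ0] at hk
  have h4 : (0 : ℝ) ≤ ψ 1 := NNReal.coe_nonneg _
  rw [hδ] at h3
  nlinarith

/-- Minimum-norm interpolation: the interpolation conditions `⟨ν_m, g⟩ = z_m` have a solution `g`
that is a Banach conjugate of an element of the span of the `ν_m`. -/
theorem exists_interpolant_mem_dualityMap {ν : Fin M → X} (hν : LinearIndependent ℝ ν)
    (z : Fin M → ℝ) :
    ∃ (g : StrongDual ℝ X) (a : Fin M → ℝ), (∀ m, g (ν m) = z m) ∧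
      g ∈ dualityMap (∑ m, a m • ν m) := by
  obtain ⟨V, b, hbν⟩ : ∃ (V : Submodule ℝ X) (b : Module.Basis (Fin M) ℝ V),
      ∀ m, ((b m : V) : X) = ν m :=
    ⟨_, Module.Basis.span hν, fun m => Module.Basis.coe_span_apply hν m⟩
  have : FiniteDimensional ℝ V := Module.Basis.finiteDimensional_of_finite b
  let φ : StrongDual ℝ V := LinearMap.toContinuousLinearMap (b.constr ℝ z)
  have hφ : ∀ m, φ (b m) = z m := fun m => by simp [φ]
  obtain ⟨g, hg, hgn⟩ := exists_extension_norm_eq V φ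
  obtain ⟨v, hv, hvmax⟩ := (isCompact_closedBall (0 : V) 1).exists_isMaxOn
    ⟨0, by simp⟩ φ.continuous.continuousOn
  have hv1 : ‖v‖ ≤ 1 := by simpa using hv
  have hvφ : φ v = ‖φ‖ := by
    refine le_antisymm ((le_abs_self _).trans ((φ.le_opNorm v).trans
      (mul_le_of_le_one_right (norm_nonneg _) hv1))) ?_
    have hv0 : 0 ≤ φ v := by simpa using hvmax (show (0 : V) ∈ Metric.closedBall (0 : V) 1 by simp)
    refine φ.opNorm_le_of_unit_norm hv0 fun x hx => ?_
    rw [Real.norm_eq_abs, abs_le]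
    constructor
    · have := hvmax (show -x ∈ Metric.closedBall (0 : V) 1 by simp [hx])
      simp only [Set.mem_ofPred_eq, map_neg] at this
      linarith
    · exact hvmax (show x ∈ Metric.closedBall (0 : V) 1 by simp [hx])
  let w : V := ‖φ‖ • v
  have hw : ‖w‖ = ‖φ‖ := by
    rw [norm_smul, Real.norm_of_nonneg (norm_nonneg φ)]
    -- If `φ = 0` the maximizer `v` need not have norm one, but then `w = 0`.
    rcases (norm_nonneg φ).eq_or_lt with h | h
    · rw [← h, zero_mul]
    · have : ‖φ‖ ≤ ‖φ‖ * ‖v‖ := by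
        conv_lhs => rw [← hvφ]
        exact (le_abs_self _).trans (φ.le_opNorm v)
      exact le_antisymm (mul_le_of_le_one_right h.le hv1) this
  have hsum : ∑ m, b.repr w m • ν m = (w : X) := by
    conv_rhs => rw [← b.sum_repr w]
    simp only [Submodule.coe_sum, Submodule.coe_smul, hbν]
  refine ⟨g, b.repr w, fun m => ?_, ?_⟩
  · rw [← hbν, hg, hφ]
  · rw [hsum]
    refine ⟨by rw [hgn, ← hw, Submodule.coe_norm], ?_⟩
    rw [hg, hgn, ← Submodule.coe_norm, hw]
    simp [w, hvφ]

/-- The objective attains its minimum. -/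
theorem solutionSet_nonempty {ν : Fin M → X} (hν : LinearIndependent ℝ ν)
    {E : (Fin M → ℝ) → (Fin M → ℝ) → ℝ≥0∞} {y : Fin M → ℝ}
    (hE_proper : ∃ z, E y z ≠ ∞) (hE_lsc : LowerSemicontinuous (E y))
    {ψ : ℝ≥0 → ℝ≥0} (hψ_mono : StrictMono ψ) (hψ : ConvexOn ℝ≥0 Set.univ ψ) :
    (solutionSet E y ν ψ).Nonempty := by
  obtain ⟨z, hz⟩ := hE_proper
  obtain ⟨g, -, hg, -⟩ := exists_interpolant_mem_dualityMap hν z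
  have hgfin : objective E y ν ψ g ≠ ∞ := by
    unfold objective
    rw [funext hg]
    exact ENNReal.add_ne_top.2 ⟨hz, ENNReal.coe_ne_top⟩
  -- Outside the ball of radius `R` the term `ψ ‖f‖` alone exceeds the finite value at `g`, so it
  -- suffices to minimize over that compact ball.
  obtain ⟨R, hR⟩ := exists_lt_of_strictMono_of_convexOn hψ_mono hψ
    (objective E y ν ψ g).toNNReal
  have hlsc : LowerSemicontinuous
      (fun f : WeakDual ℝ X => objective E y ν ψ (WeakDual.toStrongDual f)) := by
    unfold objective
    refine LowerSemicontinuous.add ?_ ?_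
    · exact LowerSemicontinuous.comp hE_lsc
        (continuous_pi fun m => WeakDual.eval_continuous (ν m))
    · have h := (ENNReal.continuous_coe.comp
        (continuous_of_strictMono_of_convexOn hψ_mono hψ)).comp_lowerSemicontinuous
        (lowerSemicontinuous_nnnorm_weakDual (X := X))
        (fun s t hst => ENNReal.coe_le_coe.2 (hψ_mono.monotone hst))
      exact h
  have hbig : ∀ f : StrongDual ℝ X, ¬ ‖f‖ ≤ R → objective E y ν ψ g < objective E y ν ψ f := by
    intro f hf
    have h1 : R < ‖f‖₊ := by
      rw [not_le] at hf
      exact_mod_cast hf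
    calc objective E y ν ψ g = ((objective E y ν ψ g).toNNReal : ℝ≥0∞) :=
          (ENNReal.coe_toNNReal hgfin).symm
      _ < (ψ ‖f‖₊ : ℝ≥0∞) := ENNReal.coe_lt_coe.2 (hR.trans (hψ_mono h1))
      _ ≤ objective E y ν ψ f := le_add_self
  have hgR : ‖g‖ ≤ R := by
    by_contra h
    exact lt_irrefl _ (hbig g h)
  obtain ⟨f, hf, hfmin⟩ := LowerSemicontinuousOn.exists_isMinOn
    (s := WeakDual.toStrongDual ⁻¹' Metric.closedBall (0 : StrongDual ℝ X) R)
    ⟨StrongDual.toWeakDual g, by simpa using hgR⟩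
    (WeakDual.isCompact_closedBall (𝕜 := ℝ) 0 (R : ℝ)) (hlsc.lowerSemicontinuousOn _)
  refine ⟨WeakDual.toStrongDual f, fun h => ?_⟩
  by_cases hh : ‖h‖ ≤ R
  · exact hfmin (show StrongDual.toWeakDual h ∈ _ by simpa using hh)
  · exact (hfmin (show StrongDual.toWeakDual g ∈ _ by simpa using hgR)).trans (hbig h hh).le

theorem objective_ne_top_of_mem_solutionSet {ν : Fin M → X} (hν : LinearIndependent ℝ ν)
    {E : (Fin M → ℝ) → (Fin M → ℝ) → ℝ≥0∞} {y : Fin M → ℝ} (hE_proper : ∃ z, E y z ≠ ∞)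
    {ψ : ℝ≥0 → ℝ≥0} {f : StrongDual ℝ X} (hf : f ∈ solutionSet E y ν ψ) :
    objective E y ν ψ f ≠ ∞ := by
  obtain ⟨z, hz⟩ := hE_proper
  obtain ⟨g, -, hg, -⟩ := exists_interpolant_mem_dualityMap hν z
  refine ne_top_of_le_ne_top ?_ (hf g)
  unfold objective
  rw [funext hg]
  exact ENNReal.add_ne_top.2 ⟨hz, ENNReal.coe_ne_top⟩

/-- Two solutions have the same measurements and the same norm. -/
theorem eq_of_mem_solutionSet {ν : Fin M → X} (hν : LinearIndependent ℝ ν)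
    {E : (Fin M → ℝ) → (Fin M → ℝ) → ℝ≥0∞} {y : Fin M → ℝ}
    (hE_proper : ∃ z, E y z ≠ ∞) (hE_strict : EStrictConvex (E y))
    {ψ : ℝ≥0 → ℝ≥0} (hψ_mono : StrictMono ψ) (hψ : StrictConvexOn ℝ≥0 Set.univ ψ)
    {f g : StrongDual ℝ X} (hf : f ∈ solutionSet E y ν ψ) (hg : g ∈ solutionSet E y ν ψ) :
    (∀ m, f (ν m) = g (ν m)) ∧ ‖f‖ = ‖g‖ := by
  have hfin := objective_ne_top_of_mem_solutionSet hν hE_proper hf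
  have hgin := objective_ne_top_of_mem_solutionSet hν hE_proper hg
  have hfg : objective E y ν ψ f = objective E y ν ψ g := le_antisymm (hf g) (hg f)
  obtain ⟨hEf, -⟩ := ENNReal.add_ne_top.1 hfin
  obtain ⟨hEg, -⟩ := ENNReal.add_ne_top.1 hgin
  let h : StrongDual ℝ X := (1 / 2 : ℝ) • f + (1 - 1 / 2 : ℝ) • g
  have hh := hf h
  have hhalf : ENNReal.ofReal (1 / 2) = 2⁻¹ := by
    rw [one_div, ENNReal.ofReal_inv_of_pos two_pos]; simp
  have hhalf' : ENNReal.ofReal (1 - 1 / 2) = 2⁻¹ := by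
    rw [← hhalf]; norm_num
  have hnorm : ‖h‖₊ ≤ (1 / 2 : ℝ≥0) • ‖f‖₊ + (1 / 2 : ℝ≥0) • ‖g‖₊ := by
    rw [← NNReal.coe_le_coe]
    push_cast
    refine (norm_add_le _ _).trans (le_of_eq ?_)
    rw [norm_smul, norm_smul]
    norm_num
  have hψle : (ψ ‖h‖₊ : ℝ≥0∞) ≤ 2⁻¹ * ψ ‖f‖₊ + 2⁻¹ * ψ ‖g‖₊ := by
    have h2 := (hψ_mono.monotone hnorm).trans (hψ.convexOn.2 (Set.mem_univ _) (Set.mem_univ _)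
      zero_le zero_le (add_halves 1))
    have h3 := ENNReal.coe_le_coe.2 h2
    simpa using h3
  have havg : 2⁻¹ * objective E y ν ψ f + 2⁻¹ * objective E y ν ψ g = objective E y ν ψ f := by
    rw [← hfg, ← add_mul, ENNReal.inv_two_add_inv_two, one_mul]
  have hsplit : 2⁻¹ * objective E y ν ψ f + 2⁻¹ * objective E y ν ψ g =
      (2⁻¹ * E y (fun m => f (ν m)) + 2⁻¹ * E y (fun m => g (ν m))) +
        (2⁻¹ * ψ ‖f‖₊ + 2⁻¹ * ψ ‖g‖₊) := by
    unfold objective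
    ring
  have hm : ∀ m, f (ν m) = g (ν m) := by
    by_contra hne
    have hne' : (fun m => f (ν m)) ≠ fun m => g (ν m) := fun hc => hne (congrFun hc)
    have hlt := hE_strict _ _ hne' hEf hEg (1 / 2) (by norm_num) (by norm_num)
    rw [hhalf, hhalf'] at hlt
    have hlt' : E y (fun m => h (ν m)) <
        2⁻¹ * E y (fun m => f (ν m)) + 2⁻¹ * E y (fun m => g (ν m)) := hlt
    have : objective E y ν ψ h < objective E y ν ψ f := by
      rw [← havg, hsplit]
      exact ENNReal.add_lt_add_of_lt_of_le ENNReal.coe_ne_top hlt' hψle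
    exact absurd hh this.not_ge
  refine ⟨hm, ?_⟩
  -- With equal data the `E`-term of the midpoint is the same finite number, so the strict decrease
  -- now comes from `ψ`.
  by_contra hne
  have hne' : ‖f‖₊ ≠ ‖g‖₊ := fun hc => hne (congrArg NNReal.toReal hc)
  have hlt : ψ ‖h‖₊ < (1 / 2 : ℝ≥0) • ψ ‖f‖₊ + (1 / 2 : ℝ≥0) • ψ ‖g‖₊ :=
    (hψ_mono.monotone hnorm).trans_lt (hψ.2 (Set.mem_univ _) (Set.mem_univ _) hne'
      (by norm_num) (by norm_num) (add_halves 1))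
  have hlt' : (ψ ‖h‖₊ : ℝ≥0∞) < 2⁻¹ * ψ ‖f‖₊ + 2⁻¹ * ψ ‖g‖₊ := by
    have := ENNReal.coe_lt_coe.2 hlt
    simpa using this
  have hmf : (fun m => g (ν m)) = fun m => f (ν m) := funext fun m => (hm m).symm
  have hEh : (fun m => h (ν m)) = fun m => f (ν m) := by
    funext m
    simp only [h, add_apply, smul_apply, hm m, smul_eq_mul]
    ring
  have : objective E y ν ψ h < objective E y ν ψ f := by
    rw [← havg, hsplit, hmf, ← add_mul, ENNReal.inv_two_add_inv_two, one_mul]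
    unfold objective
    rw [hEh]
    exact ENNReal.add_lt_add_left hEf hlt'
  exact absurd hh this.not_ge

/-- The solution set consists of the minimum-norm interpolants of one data vector `z`, and these
are conjugate to an element of the span of the `ν_m`. -/
theorem exists_solutionSet_eq {ν : Fin M → X} (hν : LinearIndependent ℝ ν)
    {E : (Fin M → ℝ) → (Fin M → ℝ) → ℝ≥0∞} {y : Fin M → ℝ}
    (hE_proper : ∃ z, E y z ≠ ∞) (hE_lsc : LowerSemicontinuous (E y))
    (hE_strict : EStrictConvex (E y))
    {ψ : ℝ≥0 → ℝ≥0} (hψ_mono : StrictMono ψ) (hψ : StrictConvexOn ℝ≥0 Set.univ ψ) :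
    ∃ (z a : Fin M → ℝ) (r : ℝ), 0 ≤ r ∧
      solutionSet E y ν ψ = {f | (∀ m, f (ν m) = z m) ∧ ‖f‖ ≤ r} ∧
      (solutionSet E y ν ψ).Nonempty ∧
      ‖∑ m, a m • ν m‖ = r ∧ ∑ m, a m * z m = r * r := by
  obtain ⟨f₀, hf₀⟩ := solutionSet_nonempty hν hE_proper hE_lsc hψ_mono hψ.convexOn
  obtain ⟨g, a, hg, hgn, hga⟩ := exists_interpolant_mem_dualityMap hν (fun m => f₀ (ν m))
  have heval : ∀ f : StrongDual ℝ X, (∀ m, f (ν m) = f₀ (ν m)) →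
      f (∑ m, a m • ν m) = ∑ m, a m * f₀ (ν m) := fun f hf => by simp [hf]
  -- `g` and `f₀` agree on the span, so `f₀` also takes the value `‖g‖ ^ 2` at a vector of norm
  -- `‖g‖`.
  have hle : ‖g‖ ≤ ‖f₀‖ := by
    have h1 : ‖g‖ * ‖g‖ ≤ ‖f₀‖ * ‖g‖ := by
      calc ‖g‖ * ‖g‖ = f₀ (∑ m, a m • ν m) := by
            rw [heval f₀ fun _ => rfl, ← heval g hg, hga, hgn]
        _ ≤ ‖f₀‖ * ‖g‖ := by rw [hgn]; exact (le_abs_self _).trans (f₀.le_opNorm _)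
    rcases (norm_nonneg g).eq_or_lt with h | h
    · rw [← h]; exact norm_nonneg _
    · exact le_of_mul_le_mul_right h1 h
  have hmem : ∀ f : StrongDual ℝ X, (∀ m, f (ν m) = f₀ (ν m)) → ‖f‖ ≤ ‖f₀‖ →
      f ∈ solutionSet E y ν ψ := by
    intro f hf hfn k
    refine le_trans ?_ (hf₀ k)
    unfold objective
    rw [funext hf]
    gcongr
    exact hψ_mono.monotone hfn
  have hgS := hmem g hg hle
  refine ⟨fun m => f₀ (ν m), a, ‖g‖, norm_nonneg _, ?_, ⟨f₀, hf₀⟩, hgn.symm, ?_⟩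
  · ext f
    constructor
    · intro hf
      exact ⟨(eq_of_mem_solutionSet hν hE_proper hE_strict hψ_mono hψ hf hf₀).1,
        (eq_of_mem_solutionSet hν hE_proper hE_strict hψ_mono hψ hf hgS).2.le⟩
    · rintro ⟨h1, h2⟩
      exact hmem f h1 (h2.trans hle)
  · rw [← heval g hg, hga, hgn]

end Optimization

/-! ### Extreme points of sections of convex sets -/

section Faces

variable {V : Type*} [NormedAddCommGroup V] [NormedSpace ℝ V] {C : Set V}

theorem Convex.add_smul_mem_of_le (hC : Convex ℝ C) {x d : V} (hx : x ∈ C) {δ ε : ℝ}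
    (hδ : 0 ≤ δ) (hδε : δ ≤ ε) (hε : x + ε • d ∈ C) : x + δ • d ∈ C := by
  rcases (hδ.trans hδε).eq_or_lt with h | h
  · have : δ = 0 := le_antisymm (h ▸ hδε) hδ
    simpa [this] using hx
  · have := hC.add_smul_mem hx hε (t := δ / ε) ⟨by positivity, div_le_one_of_le₀ hδε h.le⟩
    rwa [smul_smul, div_mul_cancel₀ _ h.ne'] at this

/-- The directions in which a point `x` of a convex set `C` is interior: the direction space of the
smallest face of `C` that contains `x`. -/
def Convex.faceDirections (hC : Convex ℝ C) {x : V} (hx : x ∈ C) : Submodule ℝ V where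
  carrier := {d | ∃ ε : ℝ, 0 < ε ∧ x + ε • d ∈ C ∧ x + ε • (-d) ∈ C}
  zero_mem' := ⟨1, one_pos, by simpa using hx, by simpa using hx⟩
  add_mem' := by
    rintro d₁ d₂ ⟨ε₁, h₁, p₁, m₁⟩ ⟨ε₂, h₂, p₂, m₂⟩
    have key : ∀ u v : V, x + ε₁ • u ∈ C → x + ε₂ • v ∈ C →
        x + (min ε₁ ε₂ / 2) • (u + v) ∈ C := by
      intro u v hu hv
      have hu' := hC.add_smul_mem_of_le hx (lt_min h₁ h₂).le (min_le_left _ _) hu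
      have hv' := hC.add_smul_mem_of_le hx (lt_min h₁ h₂).le (min_le_right _ _) hv
      have h := hC hu' hv' (by norm_num : (0 : ℝ) ≤ 1 / 2) (by norm_num : (0 : ℝ) ≤ 1 / 2)
        (by norm_num)
      convert h using 1
      module
    refine ⟨min ε₁ ε₂ / 2, half_pos (lt_min h₁ h₂), key _ _ p₁ p₂, ?_⟩
    rw [neg_add]
    exact key _ _ m₁ m₂
  smul_mem' := by
    rintro c d ⟨ε, h, p, m⟩
    rcases lt_trichotomy c 0 with hc | hc | hc
    · refine ⟨ε / (-c), div_pos h (neg_pos.2 hc), ?_, ?_⟩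
      · convert m using 2
        rw [smul_smul, smul_neg, ← neg_smul]
        congr 1
        rw [div_neg, neg_mul, div_mul_cancel₀ _ hc.ne]
      · convert p using 2
        rw [← neg_smul, smul_smul]
        congr 1
        rw [div_neg, neg_mul_neg, div_mul_cancel₀ _ hc.ne]
    · exact ⟨1, one_pos, by simpa [hc] using hx, by simpa [hc] using hx⟩
    · refine ⟨ε / c, div_pos h hc, ?_, ?_⟩
      · rwa [smul_smul, div_mul_cancel₀ _ hc.ne']
      · rwa [← smul_neg, smul_smul, div_mul_cancel₀ _ hc.ne']

/-- Contracting `C` towards `y` by the factor `s` maps a segment in `C` centred at `x` to one in `C`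
centred at `f`. -/
theorem Convex.faceDirections_le (hC : Convex ℝ C) {x y f : V} (hx : x ∈ C) (hy : y ∈ C)
    (hf : f ∈ C) {s t : ℝ} (hs : 0 < s) (ht : 0 ≤ t) (hst : s + t = 1)
    (h : f = s • x + t • y) : hC.faceDirections hx ≤ hC.faceDirections hf := by
  rintro d ⟨ε, hε, p, m⟩
  refine ⟨s * ε, mul_pos hs hε, ?_, ?_⟩
  · convert hC p hy hs.le ht hst using 1
    rw [h]; module
  · convert hC m hy hs.le ht hst using 1
    rw [h]; module

/-- If `x = a • x₁ + b • x₂`, then `x₂ - x = -(a / b) • (x₁ - x)`, so `x₁ - x` is a face direction.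
-/
theorem Convex.mem_extremePoints_of_faceDirections_eq_bot (hC : Convex ℝ C) {x : V} (hx : x ∈ C)
    (h : hC.faceDirections hx = ⊥) : x ∈ Set.extremePoints ℝ C := by
  refine mem_extremePoints_iff_left.2 ⟨hx, ?_⟩
  rintro x₁ h₁ x₂ h₂ ⟨a, b, ha, hb, hab, hxe⟩
  have hmem : x₁ - x ∈ hC.faceDirections hx := by
    have h1 : x + (1 : ℝ) • (x₁ - x) ∈ C := by simpa using h₁
    have h2 : x + (a / b) • (-(x₁ - x)) ∈ C := by
      convert h₂ using 1
      have hb' : b ≠ 0 := hb.ne'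
      have : x = (b⁻¹) • x - (a / b) • x := by
        rw [← sub_smul, show b⁻¹ - a / b = 1 by field_simp; linarith, one_smul]
      have h3 : x₂ = b⁻¹ • x - (a / b) • x₁ := by
        rw [← hxe, smul_add, smul_smul, smul_smul, inv_mul_cancel₀ hb', one_smul,
          show b⁻¹ * a = a / b by field_simp]
        abel
      rw [h3]
      nth_rewrite 1 [this]
      module
    have hab' : 0 < a / b := div_pos ha hb
    exact ⟨min 1 (a / b), lt_min one_pos hab',
      hC.add_smul_mem_of_le hx (lt_min one_pos hab').le (min_le_left _ _) h1,
      hC.add_smul_mem_of_le hx (lt_min one_pos hab').le (min_le_right _ _) h2⟩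
  rw [h, Submodule.mem_bot, sub_eq_zero] at hmem
  exact hmem

/-- Moving from `f` in a face direction until `C` is left lowers the face. -/
theorem Convex.exists_faceDirections_lt (hC : Convex ℝ C) (hcl : IsClosed C)
    (hbd : Bornology.IsBounded C) {f d : V} (hf : f ∈ C) (hd : d ∈ hC.faceDirections hf)
    (hd0 : d ≠ 0) :
    ∃ t : ℝ, 0 < t ∧ ∃ hg : f + t • d ∈ C, hC.faceDirections hg < hC.faceDirections hf := by
  obtain ⟨ε, hε, p, m⟩ := hd
  have hdn : 0 < ‖d‖ := norm_pos_iff.2 hd0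
  obtain ⟨B, hB⟩ := hbd.exists_norm_le
  have hcont : Continuous fun t : ℝ => f + t • d := by fun_prop
  have hcomp : IsCompact (Set.Icc 0 ((B + ‖f‖) / ‖d‖) ∩ (fun t : ℝ => f + t • d) ⁻¹' C) :=
    isCompact_Icc.inter_right (hcl.preimage hcont)
  have hbound : ∀ t : ℝ, 0 ≤ t → f + t • d ∈ C → t ≤ (B + ‖f‖) / ‖d‖ := by
    intro t ht htC
    rw [le_div_iff₀ hdn]
    calc t * ‖d‖ = ‖(f + t • d) - f‖ := by
          rw [add_sub_cancel_left, norm_smul, Real.norm_of_nonneg ht]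
      _ ≤ ‖f + t • d‖ + ‖f‖ := norm_sub_le _ _
      _ ≤ B + ‖f‖ := by gcongr; exact hB _ htC
  have hεmem : ε ∈ Set.Icc 0 ((B + ‖f‖) / ‖d‖) ∩ (fun t : ℝ => f + t • d) ⁻¹' C :=
    ⟨⟨hε.le, hbound ε hε.le p⟩, p⟩
  -- `t` is the last parameter at which the ray is in `C`. Since `f` lies between `f + t • d` and `f
  -- - ε • d`, the directions at the exit point are among those at `f`; `d` itself is lost, as it
  -- would allow going past `t`.
  obtain ⟨t, ⟨-, htC⟩, htmax⟩ := hcomp.exists_isMaxOn ⟨ε, hεmem⟩ continuousOn_id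
  have ht : 0 < t := hε.trans_le (htmax hεmem)
  have hg : f + t • d ∈ C := htC
  refine ⟨t, ht, hg, lt_of_le_of_ne ?_ ?_⟩
  · have hs : 0 < ε + t := by positivity
    refine hC.faceDirections_le hg m hf (s := ε / (ε + t)) (t := t / (ε + t)) (by positivity)
      (by positivity) (by rw [← add_div, div_self hs.ne']) ?_
    have h1 : ε / (ε + t) + t / (ε + t) = 1 := by rw [← add_div, div_self hs.ne']
    have h2 : (ε / (ε + t)) * t - (t / (ε + t)) * ε = 0 := by field_simp; ring
    calc f = (ε / (ε + t) + t / (ε + t)) • f + ((ε / (ε + t)) * t - (t / (ε + t)) * ε) • d := by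
          rw [h1, h2]; simp
      _ = _ := by module
  · intro heq
    have hdg : d ∈ hC.faceDirections hg := heq ▸ (⟨ε, hε, p, m⟩ : d ∈ hC.faceDirections hf)
    obtain ⟨η, hη, q, -⟩ := hdg
    have hq : f + (t + η) • d ∈ C := by
      rw [add_smul, ← add_assoc]; exact q
    have := htmax (show t + η ∈ _ from
      ⟨⟨by positivity, hbound _ (by positivity) hq⟩, hq⟩)
    simp only [id, Set.mem_ofPred_eq] at this
    linarith

/-- A point of a finite-dimensional face is a proper convex combination of an extreme point and
another point. -/
theorem Convex.exists_extremePoint_combination (hC : Convex ℝ C) (hcl : IsClosed C)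
    (hbd : Bornology.IsBounded C) (k : ℕ) {f : V} (hf : f ∈ C)
    (hfin : FiniteDimensional ℝ (hC.faceDirections hf))
    (hk : Module.finrank ℝ (hC.faceDirections hf) = k) :
    ∃ e ∈ Set.extremePoints ℝ C, ∃ x ∈ C, ∃ s t : ℝ, 0 < s ∧ 0 ≤ t ∧ s + t = 1 ∧
      f = s • e + t • x := by
  induction k using Nat.strong_induction_on generalizing f with
  | _ k ih =>
  by_cases hbot : hC.faceDirections hf = ⊥
  · exact ⟨f, hC.mem_extremePoints_of_faceDirections_eq_bot hf hbot, f, hf, 1, 0, by simp⟩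
  · obtain ⟨d, hd, hd0⟩ := Submodule.exists_mem_ne_zero_of_ne_bot hbot
    obtain ⟨t, ht, hg, hlt⟩ := hC.exists_faceDirections_lt hcl hbd hf hd hd0
    obtain ⟨e, he, x, hx, s', t', hs', ht', hst', hge⟩ := ih _
      (hk ▸ Submodule.finrank_lt_finrank_of_lt hlt) hg
      (Submodule.finiteDimensional_of_le hlt.le) rfl
    obtain ⟨ε, hε, -, m⟩ := hd
    have hpos : 0 < ε + t := by positivity
    have h1 : ε / (ε + t) + t / (ε + t) = 1 := by rw [← add_div, div_self hpos.ne']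
    set p := ε / (ε + t) with hp
    set q := t / (ε + t) with hq
    have hp0 : 0 < p := by positivity
    have hq0 : 0 < q := by positivity
    have h2 : p * t - q * ε = 0 := by rw [hp, hq]; field_simp; ring
    have hfe : f = p • (f + t • d) + q • (f + ε • (-d)) := by
      calc f = (p + q) • f + (p * t - q * ε) • d := by rw [h1, h2]; simp
        _ = _ := by module
    have hw : 0 < p * t' + q := by positivity
    -- `f` lies between the exit point, which is split by induction into `e` and `x`, and `f - ε •
    -- d`; the two points other than `e` are merged into one.
    refine ⟨e, he, ((p * t') / (p * t' + q)) • x + (q / (p * t' + q)) • (f + ε • (-d)),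
      hC hx m (by positivity) (by positivity) (by rw [← add_div, div_self hw.ne']),
      p * s', p * t' + q, by positivity, by positivity,
      by rw [← add_assoc, ← mul_add, hst', mul_one, h1], ?_⟩
    rw [smul_add, smul_smul, smul_smul, mul_div_cancel₀ _ hw.ne', mul_div_cancel₀ _ hw.ne']
    calc f = p • (f + t • d) + q • (f + ε • (-d)) := hfe
      _ = p • (s' • e + t' • x) + q • (f + ε • (-d)) := by rw [← hge]
      _ = _ := by module

/-- **Minkowski–Carathéodory**: a point of a `k`-dimensional face of a closed bounded convex set is
a combination of at most `k + 1` extreme points. -/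
theorem Convex.exists_sum_extremePoints (hC : Convex ℝ C) (hcl : IsClosed C)
    (hbd : Bornology.IsBounded C) (k : ℕ) {f : V} (hf : f ∈ C)
    (hfin : FiniteDimensional ℝ (hC.faceDirections hf))
    (hk : Module.finrank ℝ (hC.faceDirections hf) = k) :
    ∃ K ≤ k + 1, ∃ (c : Fin K → ℝ) (e : Fin K → V),
      (∀ i, e i ∈ Set.extremePoints ℝ C) ∧ f = ∑ i, c i • e i := by
  induction k using Nat.strong_induction_on generalizing f with
  | _ k ih =>
  obtain ⟨e, he, x, hx, s, t, hs, ht, hst, hfe⟩ :=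
    hC.exists_extremePoint_combination hcl hbd k hf hfin hk
  by_cases hef : f = e
  · exact ⟨1, by simp, fun _ => 1, fun _ => e, fun _ => he, by simp [hef]⟩
  have ht0 : 0 < t := by
    refine lt_of_le_of_ne ht fun h0 => hef ?_
    rw [← h0, add_zero] at hst
    rw [hfe, ← h0, hst]; simp
  have hd : f - e ∈ hC.faceDirections hf := by
    have h1 : f + (1 : ℝ) • (-(f - e)) ∈ C := by
      simpa using (extremePoints_subset he)
    have h2 : f + (s / t) • (f - e) ∈ C := by
      convert hx using 1
      have hs1 : s = 1 - t := by linarith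
      have hts : s / t * t = s := div_mul_cancel₀ _ ht0.ne'
      have : (s / t) • (f - e) = s • (x - e) := by
        rw [hfe, show s • e + t • x - e = t • (x - e) by rw [hs1]; module, smul_smul, hts]
      rw [this, hfe, hs1]; module
    have hpos : 0 < min 1 (s / t) := lt_min one_pos (div_pos hs ht0)
    exact ⟨min 1 (s / t), hpos, hC.add_smul_mem_of_le hf hpos.le (min_le_right _ _) h2,
      hC.add_smul_mem_of_le hf hpos.le (min_le_left _ _) h1⟩
  -- The ray from the extreme point `e` through `f` leaves `C` at `g = f + u • (f - e)`, in a
  -- smaller face, and `f = (u / (1 + u)) • e + (1 / (1 + u)) • g`. One extreme point is spent for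
  -- each drop in dimension.
  obtain ⟨u, hu, hg, hlt⟩ := hC.exists_faceDirections_lt hcl hbd hf hd (sub_ne_zero.2 hef)
  have hflt := Submodule.finrank_lt_finrank_of_lt hlt
  obtain ⟨K, hK, c, e', he', hsum⟩ := ih _ (hk ▸ hflt) hg
    (Submodule.finiteDimensional_of_le hlt.le) rfl
  refine ⟨K + 1, by omega, Fin.cons (u / (1 + u)) (fun i => (1 / (1 + u)) * c i),
    Fin.cons e e', Fin.cases he he', ?_⟩
  have hu1 : 0 < 1 + u := by positivity
  have h1 : 1 / (1 + u) + u / (1 + u) = 1 := by rw [← add_div, div_self hu1.ne']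
  have h2 : (1 / (1 + u)) * u = u / (1 + u) := by ring
  rw [Fin.sum_univ_succ]
  simp only [Fin.cons_zero, Fin.cons_succ, mul_smul]
  rw [← Finset.smul_sum, ← hsum]
  calc f = (1 / (1 + u) + u / (1 + u)) • f := by rw [h1, one_smul]
    _ = (u / (1 + u)) • e + ((1 / (1 + u)) • f + (u / (1 + u)) • (f - e)) := by module
    _ = _ := by rw [← h2, mul_smul _ u (f - e), ← smul_add]

theorem inv_smul_mem_extremePoints_closedBall {r : ℝ} (hr : 0 < r) {e : V}
    (he : e ∈ Set.extremePoints ℝ (Metric.closedBall (0 : V) r)) :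
    r⁻¹ • e ∈ Set.extremePoints ℝ (Metric.closedBall (0 : V) 1) := by
  rw [mem_extremePoints_iff_left] at he ⊢
  obtain ⟨hmem, hext⟩ := he
  have hscale : ∀ x ∈ Metric.closedBall (0 : V) 1, r • x ∈ Metric.closedBall (0 : V) r := by
    intro x hx
    rw [mem_closedBall_zero_iff] at hx ⊢
    rw [norm_smul, Real.norm_of_nonneg hr.le]
    exact mul_le_of_le_one_right hr.le hx
  refine ⟨?_, ?_⟩
  · rw [mem_closedBall_zero_iff] at hmem ⊢
    rw [norm_smul, norm_inv, Real.norm_of_nonneg hr.le]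
    exact inv_mul_le_one_of_le₀ hmem hr.le
  · rintro x₁ h₁ x₂ h₂ ⟨a, b, ha, hb, hab, h⟩
    have := hext _ (hscale _ h₁) _ (hscale _ h₂) ⟨a, b, ha, hb, hab, by
      rw [smul_comm a, smul_comm b, ← smul_add, h, smul_smul, mul_inv_cancel₀ hr.ne', one_smul]⟩
    rw [← this, smul_smul, inv_mul_cancel₀ hr.ne', one_smul]

end Faces

/-- An extreme point of the set of minimum-norm interpolants of `M` data is a combination of at
most `M` extreme points of the dual unit ball. -/
theorem exists_isAtomicSum_of_mem_extremePoints {M : ℕ} {X : Type*} [NormedAddCommGroup X]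
    [NormedSpace ℝ X] {ν : Fin M → X} {z a : Fin M → ℝ} {r : ℝ} (hr : 0 ≤ r)
    (ha : ‖∑ m, a m • ν m‖ = r) (haz : ∑ m, a m * z m = r * r) {f : StrongDual ℝ X}
    (hf : f ∈ Set.extremePoints ℝ {f : StrongDual ℝ X | (∀ m, f (ν m) = z m) ∧ ‖f‖ ≤ r}) :
    ∃ K ≤ M, IsAtomicSum K f := by
  obtain ⟨⟨hfz, hfr⟩, hext⟩ := mem_extremePoints_iff_left.1 hf
  rcases hr.eq_or_lt with h0 | hr0
  · have : f = 0 := by rw [← norm_le_zero_iff, h0]; exact hfr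
    exact ⟨0, Nat.zero_le _, Fin.elim0, Fin.elim0, fun k => k.elim0, by simp [this]⟩
  set ν₀ := ∑ m, a m • ν m with hν₀
  have heval : ∀ g : StrongDual ℝ X, g ν₀ = ∑ m, a m * g (ν m) := fun g => by simp [hν₀]
  -- Working in this exposed face instead of the whole ball saves one dimension, and thus gives `M`
  -- atoms rather than `M + 1`.
  let C : Set (StrongDual ℝ X) := {g | ‖g‖ ≤ r ∧ g ν₀ = r * r}
  have hball : ∀ g : StrongDual ℝ X, ‖g‖ ≤ r → g ν₀ ≤ r * r := by
    intro g hg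
    calc g ν₀ ≤ ‖g‖ * ‖ν₀‖ := (le_abs_self _).trans (g.le_opNorm _)
      _ ≤ r * r := by rw [ha]; gcongr
  have hC : Convex ℝ C := by
    rintro g ⟨hg, hg'⟩ h ⟨hh, hh'⟩ s t hs ht hst
    refine ⟨?_, ?_⟩
    · have := convex_closedBall (0 : StrongDual ℝ X) r (mem_closedBall_zero_iff.2 hg)
        (mem_closedBall_zero_iff.2 hh) hs ht hst
      exact mem_closedBall_zero_iff.1 this
    · simp only [add_apply, smul_apply, hg', hh', smul_eq_mul]
      rw [← add_mul, hst, one_mul]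
  have hcl : IsClosed C :=
    (isClosed_le continuous_norm continuous_const).inter
      (isClosed_eq (ContinuousLinearMap.apply ℝ ℝ ν₀).continuous continuous_const)
  have hbd : Bornology.IsBounded C := by
    have hsub : C ⊆ Metric.closedBall 0 r := fun g hg => mem_closedBall_zero_iff.2 hg.1
    exact Metric.isBounded_closedBall.subset hsub
  have hfC : f ∈ C := ⟨hfr, by rw [heval, ← haz]; simp [hfz]⟩
  let D := hC.faceDirections hfC
  let L : D →ₗ[ℝ] (Fin M → ℝ) :=
    { toFun := fun d m => (d : StrongDual ℝ X) (ν m)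
      map_add' := fun _ _ => rfl
      map_smul' := fun _ _ => rfl }
  have hD : ∀ d ∈ D, d ν₀ = 0 := by
    rintro d ⟨ε, hε, ⟨-, p⟩, -⟩
    simp only [add_apply, smul_apply, hfC.2, smul_eq_mul, add_eq_left, mul_eq_zero] at p
    exact p.resolve_left hε.ne'
  -- A face direction with zero measurements keeps `f ± ε • d` among the interpolants, contradicting
  -- extremality of `f` unless `d = 0`.
  have hinj : Function.Injective L := by
    rw [← LinearMap.ker_eq_bot, LinearMap.ker_eq_bot']
    rintro ⟨d, ε, hε, p, m⟩ hd
    have hd' : ∀ m, d (ν m) = 0 := congrFun hd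
    have hp : f + ε • d ∈ {f : StrongDual ℝ X | (∀ m, f (ν m) = z m) ∧ ‖f‖ ≤ r} :=
      ⟨fun m => by simp [hfz, hd'], p.1⟩
    have hm : f + ε • (-d) ∈ {f : StrongDual ℝ X | (∀ m, f (ν m) = z m) ∧ ‖f‖ ≤ r} :=
      ⟨fun m => by simp [hfz, hd'], m.1⟩
    have := hext _ hp _ hm ⟨1 / 2, 1 / 2, by norm_num, by norm_num, by norm_num, by module⟩
    rw [add_eq_left, smul_eq_zero] at this
    exact Subtype.ext (this.resolve_left hε.ne')
  have hfin : FiniteDimensional ℝ D := FiniteDimensional.of_injective L hinj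
  have hlt : Module.finrank ℝ D < M := by
    have hle : Module.finrank ℝ D ≤ M := by
      simpa using LinearMap.finrank_le_finrank_of_injective hinj
    -- If `L` were onto, some face direction would have measurements `a`; since it vanishes at `ν₀`,
    -- `∑ a m * a m = 0`, so `ν₀ = 0`, against `r > 0`.
    refine lt_of_le_of_ne hle fun heq => ?_
    have hsurj : Function.Surjective L :=
      (LinearMap.injective_iff_surjective_of_finrank_eq_finrank (by simpa using heq)).1 hinj
    obtain ⟨d, hd⟩ := hsurj a
    have h1 := hD d d.2
    rw [heval] at h1
    have h2 : ∀ m, (d : StrongDual ℝ X) (ν m) = a m := congrFun hd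
    simp only [h2] at h1
    have h3 : ∀ m, a m = 0 := fun m => by
      have := (Finset.sum_eq_zero_iff_of_nonneg fun i _ => mul_self_nonneg (a i)).1 h1 m
        (Finset.mem_univ m)
      exact mul_self_eq_zero.1 this
    rw [hν₀] at ha
    simp only [h3, zero_smul, Finset.sum_const_zero, norm_zero] at ha
    exact hr0.ne ha
  obtain ⟨K, hK, c, e, he, hsum⟩ := hC.exists_sum_extremePoints hcl hbd _ hfC hfin rfl
  have hface : IsExtreme ℝ (Metric.closedBall (0 : StrongDual ℝ X) r) C := by
    refine ⟨fun g hg => mem_closedBall_zero_iff.2 hg.1, ?_⟩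
    rintro g₁ hg₁ g₂ hg₂ g ⟨-, hg⟩ ⟨s, t, hs, ht, hst, h⟩
    rw [mem_closedBall_zero_iff] at hg₁ hg₂
    refine ⟨hg₁, le_antisymm (hball _ hg₁) ?_⟩
    have h2 := hball _ hg₂
    rw [← h] at hg
    simp only [add_apply, smul_apply, smul_eq_mul] at hg
    by_contra hlt'
    have h3 : s * g₁ ν₀ < s * (r * r) := mul_lt_mul_of_pos_left (not_le.1 hlt') hs
    have h4 : t * g₂ ν₀ ≤ t * (r * r) := mul_le_mul_of_nonneg_left h2 ht.le
    have h5 : s * (r * r) + t * (r * r) = r * r := by rw [← add_mul, hst, one_mul]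
    linarith
  refine ⟨K, hK.trans hlt, fun k => c k * r, fun k => r⁻¹ • e k, fun k =>
    inv_smul_mem_extremePoints_closedBall hr0
      (hface.extremePoints_subset_extremePoints (he k)), ?_⟩
  rw [hsum]
  refine Finset.sum_congr rfl fun k _ => ?_
  rw [smul_smul, mul_assoc, mul_inv_cancel₀ hr0.ne', mul_one]

/-! ### The duality mapping and Hilbert norms -/

section Duality

variable {X : Type*} [NormedAddCommGroup X] [NormedSpace ℝ X]

theorem dualityMap_nonempty (x : X) : (dualityMap x).Nonempty := by
  rcases eq_or_ne x 0 with rfl | hx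
  · exact ⟨0, by simp [dualityMap]⟩
  · obtain ⟨g, hg, hgx⟩ := exists_dual_vector ℝ x (norm_ne_zero_iff.2 hx)
    have hn : ‖(‖x‖ • g : StrongDual ℝ X)‖ = ‖x‖ := by
      rw [norm_smul, hg, mul_one, norm_norm]
    refine ⟨‖x‖ • g, hn, ?_⟩
    rw [hn]
    simp [hgx]

/-- Two conjugates give equality in the triangle inequality, since `f + g` takes the value `(‖f‖ +
‖g‖) * ‖x‖` at `x`. -/
theorem dualityMap_subsingleton [StrictConvexSpace ℝ (StrongDual ℝ X)] (x : X) :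
    (dualityMap x).Subsingleton := by
  rintro f ⟨hf, hfx⟩ g ⟨hg, hgx⟩
  refine eq_of_norm_eq_of_norm_add_eq (hf.trans hg.symm) (le_antisymm (norm_add_le _ _) ?_)
  rcases (norm_nonneg x).eq_or_lt with h | h
  · rw [hf, hg, ← h, add_zero]; exact norm_nonneg _
  · refine le_of_mul_le_mul_right ?_ h
    calc (‖f‖ + ‖g‖) * ‖x‖ = (f + g) x := by rw [add_apply, hfx, hgx]; ring
      _ ≤ ‖f + g‖ * ‖x‖ := (le_abs_self _).trans ((f + g).le_opNorm x)

theorem isDualityOperator_of_mem [StrictConvexSpace ℝ (StrongDual ℝ X)] {J : X → StrongDual ℝ X}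
    (hJ : ∀ x, J x ∈ dualityMap x) : IsDualityOperator J := fun x =>
  (dualityMap_subsingleton x).eq_singleton_of_mem (hJ x)

theorem exists_isDualityOperator [StrictConvexSpace ℝ (StrongDual ℝ X)] :
    ∃ J : X → StrongDual ℝ X, IsDualityOperator J :=
  ⟨fun x => (dualityMap_nonempty x).some,
    isDualityOperator_of_mem fun x => (dualityMap_nonempty x).some_mem⟩

theorem HasHilbertNorm.innerProductSpaceable {H : Type*} [NormedAddCommGroup H] [NormedSpace ℝ H]
    (h : HasHilbertNorm H) : InnerProductSpaceable H := by
  obtain ⟨B, -, hB⟩ := h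
  refine ⟨fun x y => ?_⟩
  simp only [← pow_two, ← hB, map_add, map_sub, LinearMap.add_apply, LinearMap.sub_apply]
  ring

theorem HasHilbertNorm.strictConvexSpace {H : Type*} [NormedAddCommGroup H] [NormedSpace ℝ H]
    (h : HasHilbertNorm H) : StrictConvexSpace ℝ H :=
  have := h.innerProductSpaceable
  inferInstance

/-- The parallelogram identity passes from the dual to the space. -/
theorem innerProductSpaceable_of_dual [InnerProductSpaceable (StrongDual ℝ X)] :
    InnerProductSpaceable X := by
  have key : ∀ x y : X, ‖x + y‖ * ‖x + y‖ + ‖x - y‖ * ‖x - y‖ ≤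
      2 * (‖x‖ * ‖x‖ + ‖y‖ * ‖y‖) := by
    intro x y
    obtain ⟨f, hf, hfx⟩ := dualityMap_nonempty (x + y)
    obtain ⟨g, hg, hgx⟩ := dualityMap_nonempty (x - y)
    have hp := InnerProductSpaceable.parallelogram_identity f g
    have h1 : (f + g) x ≤ ‖f + g‖ * ‖x‖ := (le_abs_self _).trans ((f + g).le_opNorm x)
    have h2 : (f - g) y ≤ ‖f - g‖ * ‖y‖ := (le_abs_self _).trans ((f - g).le_opNorm y)
    rw [hf] at hfx hp
    rw [hg] at hgx hp
    simp only [add_apply, sub_apply] at h1 h2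
    rw [map_add] at hfx
    rw [map_sub] at hgx
    -- The left side equals `(f + g) x + (f - g) y`. The bound `‖f + g‖ * ‖x‖ ≤ ‖f + g‖ ^ 2 / 4 +
    -- ‖x‖ ^ 2`, its analogue for `f - g`, and the parallelogram identity in the dual bound it by
    -- half of itself plus `‖x‖ ^ 2 + ‖y‖ ^ 2`.
    nlinarith [sq_nonneg (‖f + g‖ - 2 * ‖x‖), sq_nonneg (‖f - g‖ - 2 * ‖y‖)]
  refine ⟨fun x y => le_antisymm (key x y) ?_⟩
  -- The inequality applied to sum and difference is its own converse.
  have h := key (x + y) (x - y)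
  have e1 : x + y + (x - y) = (2 : ℝ) • x := by module
  have e2 : x + y - (x - y) = (2 : ℝ) • y := by module
  rw [e1, e2, norm_smul, norm_smul, Real.norm_ofNat] at h
  linarith

theorem exists_isRieszMap_of_dual_hasHilbertNorm (h : HasHilbertNorm (StrongDual ℝ X)) :
    ∃ R : X →L[ℝ] StrongDual ℝ X, IsRieszMap R ∧ IsDualityOperator R := by
  have := h.innerProductSpaceable
  have := h.strictConvexSpace
  have hX := innerProductSpaceable_of_dual (X := X)
  let : InnerProductSpace ℝ X := InnerProductSpace.ofNorm ℝ hX.parallelogram_identity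
  let R : X →L[ℝ] StrongDual ℝ X := (innerₗ X).mkContinuous₂ 1 fun x y => by
    rw [one_mul]
    exact norm_inner_le_norm (𝕜 := ℝ) x y
  have hR : ∀ x y, R x y = inner ℝ x y := fun x y => rfl
  refine ⟨R, ⟨fun x y => ?_, fun x => ?_⟩, isDualityOperator_of_mem fun x => ?_⟩
  · rw [hR, hR, real_inner_comm]
  · rw [hR, real_inner_self_eq_norm_sq]
  · have hn : ‖R x‖ = ‖x‖ := by
      refine le_antisymm ?_ ?_
      · refine (R x).opNorm_le_bound (norm_nonneg x) fun y => ?_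
        rw [hR]
        exact norm_inner_le_norm (𝕜 := ℝ) x y
      · rcases (norm_nonneg x).eq_or_lt with h0 | h0
        · rw [← h0]; exact norm_nonneg _
        · refine le_of_mul_le_mul_right ?_ h0
          rw [← real_inner_self_eq_norm_mul_norm, ← hR]
          exact (le_abs_self _).trans ((R x).le_opNorm x)
    refine ⟨hn, ?_⟩
    rw [hn, hR, real_inner_self_eq_norm_mul_norm]

end Duality

/-! ### Dual norms of absolute norms -/

namespace AbsoluteNorm

variable {N : ℕ} (ρ : AbsoluteNorm N)

theorem apply_single_pos (n : Fin N) : 0 < ρ (Pi.single n 1) := by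
  refine lt_of_le_of_ne (apply_nonneg ρ.toSeminorm _) fun h => ?_
  have := congrFun (ρ.definite _ h.symm) n
  simp at this

theorem abs_apply_le (z : Fin N → ℝ) (n : Fin N) : |z n| ≤ ρ z / ρ (Pi.single n 1) := by
  rw [le_div_iff₀ (ρ.apply_single_pos n)]
  have h : ρ (|z n| • (Pi.single n 1 : Fin N → ℝ)) ≤ ρ z := by
    refine ρ.mono _ _ fun k => ?_
    rcases eq_or_ne k n with rfl | hk
    · simp
    · simp [hk]
  rwa [map_smul_eq_mul, Real.norm_eq_abs, abs_abs] at h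

theorem bddAbove_dualNorm (y : Fin N → ℝ) :
    BddAbove {r | ∃ z : Fin N → ℝ, ρ z ≤ 1 ∧ r = ∑ n, y n * z n} := by
  refine ⟨∑ n, |y n| * (1 / ρ (Pi.single n 1)), ?_⟩
  rintro _ ⟨z, hz, rfl⟩
  refine Finset.sum_le_sum fun n _ => (le_abs_self _).trans ?_
  rw [abs_mul]
  refine mul_le_mul_of_nonneg_left ((ρ.abs_apply_le z n).trans ?_) (abs_nonneg _)
  exact div_le_div_of_nonneg_right hz (ρ.apply_single_pos n).le

theorem dualNorm_le {y : Fin N → ℝ} {c : ℝ}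
    (h : ∀ z : Fin N → ℝ, ρ z ≤ 1 → ∑ n, y n * z n ≤ c) : ρ.dualNorm y ≤ c := by
  refine csSup_le ⟨0, 0, ?_, by simp⟩ ?_
  · rw [map_zero]; exact zero_le_one
  · rintro _ ⟨z, hz, rfl⟩
    exact h z hz

theorem sum_mul_le_dualNorm (y : Fin N → ℝ) {z : Fin N → ℝ} (hz : ρ z ≤ 1) :
    ∑ n, y n * z n ≤ ρ.dualNorm y :=
  le_csSup (ρ.bddAbove_dualNorm y) ⟨z, hz, rfl⟩

theorem sum_mul_le (y z : Fin N → ℝ) : ∑ n, y n * z n ≤ ρ.dualNorm y * ρ z := by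
  rcases (apply_nonneg ρ.toSeminorm z).eq_or_lt with h | h
  · have hz : z = 0 := ρ.definite z h.symm
    rw [← h, hz]; simp
  · have h1 : ρ ((ρ z)⁻¹ • z) ≤ 1 := by
      rw [map_smul_eq_mul, norm_inv, Real.norm_of_nonneg h.le, inv_mul_cancel₀ h.ne']
    have h2 := ρ.sum_mul_le_dualNorm y h1
    have h3 : ∑ n, y n * ((ρ z)⁻¹ • z) n = (∑ n, y n * z n) / ρ z := by
      rw [Finset.sum_div]
      refine Finset.sum_congr rfl fun n _ => ?_
      simp only [Pi.smul_apply, smul_eq_mul]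
      field_simp
    rwa [h3, div_le_iff₀ h] at h2

/-- A test vector may be replaced by its absolute values, which have the same norm. -/
theorem dualNorm_mono {u v : Fin N → ℝ} (h : ∀ n, |u n| ≤ v n) : ρ.dualNorm u ≤ ρ.dualNorm v := by
  refine ρ.dualNorm_le fun z hz => ?_
  have hz' : ρ (fun n => |z n|) ≤ 1 := (ρ.absolute z).trans_le hz
  refine le_trans (Finset.sum_le_sum fun n _ => ?_) (ρ.sum_mul_le_dualNorm v hz')
  exact (le_abs_self _).trans (by rw [abs_mul]; exact mul_le_mul_of_nonneg_right (h n) (abs_nonneg _))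

theorem dualNorm_smul_le {t : ℝ} (ht : 0 ≤ t) (y : Fin N → ℝ) :
    ρ.dualNorm (t • y) ≤ t * ρ.dualNorm y := by
  refine ρ.dualNorm_le fun z hz => ?_
  have h : ∑ n, (t • y) n * z n = t * ∑ n, y n * z n := by
    rw [Finset.mul_sum]
    exact Finset.sum_congr rfl fun n _ => by simp [mul_assoc]
  rw [h]
  exact mul_le_mul_of_nonneg_left (ρ.sum_mul_le_dualNorm y hz) ht

theorem dualNorm_inv_smul {r : ℝ} (hr : 0 < r) {y : Fin N → ℝ} (hy : ρ.dualNorm y = r) :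
    ρ.dualNorm (r⁻¹ • y) = 1 := by
  refine le_antisymm ?_ ?_
  · refine (ρ.dualNorm_smul_le (inv_pos.2 hr).le y).trans ?_
    rw [hy, inv_mul_cancel₀ hr.ne']
  · have h := ρ.dualNorm_smul_le hr.le (r⁻¹ • y)
    rw [smul_smul, mul_inv_cancel₀ hr.ne', one_smul, hy] at h
    exact le_of_mul_le_mul_left (by rwa [mul_one]) hr

/-- The midpoint of `r⁻¹ • u` and `r⁻¹ • v` still pairs with `w` to `r = ρ w`, so its dual norm is
at least one. -/
theorem DualStrictConvex.eq_of_dualNorm_eq {ρ : AbsoluteNorm N} (hρ : ρ.DualStrictConvex) {r : ℝ}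
    (hr : 0 < r) {u v w : Fin N → ℝ} (hu : ρ.dualNorm u = r) (hv : ρ.dualNorm v = r)
    (hw : ρ w = r) (huw : ∑ n, u n * w n = r * r) (hvw : ∑ n, v n * w n = r * r) : u = v := by
  by_contra hne
  have hne' : r⁻¹ • u ≠ r⁻¹ • v := fun h => hne (smul_right_injective _ (inv_ne_zero hr.ne') h)
  have hlt := hρ _ _ (ρ.dualNorm_inv_smul hr hu) (ρ.dualNorm_inv_smul hr hv) hne' (1 / 2)
    (by norm_num) (by norm_num)
  have hle := ρ.sum_mul_le ((1 / 2 : ℝ) • r⁻¹ • u + (1 - 1 / 2 : ℝ) • r⁻¹ • v) w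
  have hsum : ∑ n, ((1 / 2 : ℝ) • r⁻¹ • u + (1 - 1 / 2 : ℝ) • r⁻¹ • v) n * w n =
      (1 / 2) * r⁻¹ * (∑ n, u n * w n) + (1 / 2) * r⁻¹ * ∑ n, v n * w n := by
    rw [Finset.mul_sum, Finset.mul_sum, ← Finset.sum_add_distrib]
    refine Finset.sum_congr rfl fun n _ => ?_
    simp only [Pi.add_apply, Pi.smul_apply, smul_eq_mul]
    ring
  rw [hsum, huw, hvw, hw] at hle
  have h1 : (1 / 2) * r⁻¹ * (r * r) + (1 / 2) * r⁻¹ * (r * r) = 1 * r := by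
    field_simp; norm_num
  rw [h1] at hle
  exact absurd (le_of_mul_le_mul_right hle hr) hlt.not_ge

/-- If the dual norm is strictly convex or the `ℓ¹` norm, then a conjugate of `u` has no zero where
`u` has none. -/
theorem ne_zero_of_conjugate {ρ : AbsoluteNorm N} (hρ : ρ.DualStrictConvex ∨ ρ.DualIsL1) {r : ℝ}
    {u w : Fin N → ℝ} (hu0 : ∀ n, 0 ≤ u n) (hu : ρ.dualNorm u = r) (hw : ρ w = r)
    (huw : ∑ n, u n * w n = r * r) {n : Fin N} (hn : u n ≠ 0) : w n ≠ 0 := by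
  intro hwn
  have hr : 0 < r := by
    have h1 := ρ.sum_mul_le u (Pi.single n 1)
    have h2 : ∑ k, u k * (Pi.single n 1 : Fin N → ℝ) k = u n := by
      simp [Pi.single_apply]
    rw [h2, hu] at h1
    have h3 : 0 < u n := lt_of_le_of_ne (hu0 n) hn.symm
    exact pos_of_mul_pos_left (h3.trans_le h1) (ρ.apply_single_pos n).le
  -- If `w n = 0`, deleting the coordinate `u n` leaves the pairing with `w` and hence the dual norm
  -- unchanged, which neither a strictly convex nor the `ℓ¹` norm permits.
  set v := Function.update u n 0 with hv
  have hvu : ∀ k, |v k| ≤ u k := by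
    intro k
    rcases eq_or_ne k n with rfl | hk
    · simp [hv, hu0]
    · simp [hv, hk, abs_of_nonneg (hu0 k)]
  have hvw : ∑ k, v k * w k = r * r := by
    rw [← huw]
    refine Finset.sum_congr rfl fun k _ => ?_
    rcases eq_or_ne k n with rfl | hk
    · simp [hwn]
    · simp [hv, hk]
  have hvr : ρ.dualNorm v = r := by
    refine le_antisymm (hu ▸ ρ.dualNorm_mono hvu) ?_
    have h := ρ.sum_mul_le v w
    rw [hvw, hw] at h
    exact le_of_mul_le_mul_right h hr
  rcases hρ with hρ | hρ
  · have h := hρ.eq_of_dualNorm_eq hr hu hvr hw huw hvw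
    have := congrFun h n
    rw [hv, Function.update_self] at this
    exact hn this
  · have h := hvr.trans hu.symm
    rw [hρ, hρ] at h
    have hlt : ∑ k, |v k| < ∑ k, |u k| := by
      refine Finset.sum_lt_sum (fun k _ => (hvu k).trans (le_abs_self _)) ⟨n, Finset.mem_univ n, ?_⟩
      simpa [hv] using hn
    exact hlt.ne h

end AbsoluteNorm

/-! ### The dual of a direct product -/

namespace DirectProd

variable {N : ℕ} {ρ : AbsoluteNorm N} {X : Fin N → Type*}
  [∀ n, NormedAddCommGroup (X n)] [∀ n, NormedSpace ℝ (X n)]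

/-- The `n`-th component as a linear map between dual spaces. -/
noncomputable def componentLinear (ρ : AbsoluteNorm N) (X : Fin N → Type*)
    [∀ n, NormedAddCommGroup (X n)] [∀ n, NormedSpace ℝ (X n)] (n : Fin N) :
    StrongDual ℝ (DirectProd ρ X) →ₗ[ℝ] StrongDual ℝ (X n) where
  toFun := component n
  map_add' f g := by ext x; rfl
  map_smul' c f := by ext x; rfl

theorem component_add (n : Fin N) (f g : StrongDual ℝ (DirectProd ρ X)) :
    component n (f + g) = component n f + component n g :=
  map_add (componentLinear ρ X n) f g

theorem component_smul (n : Fin N) (c : ℝ) (f : StrongDual ℝ (DirectProd ρ X)) :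
    component n (c • f) = c • component n f :=
  map_smul (componentLinear ρ X n) c f

theorem component_sum_smul {K : ℕ} (n : Fin N) (c : Fin K → ℝ)
    (e : Fin K → StrongDual ℝ (DirectProd ρ X)) :
    component n (∑ k, c k • e k) = ∑ k, c k • component n (e k) := by
  change componentLinear ρ X n _ = ∑ k, c k • componentLinear ρ X n (e k)
  simp

theorem apply_eq_sum_component (f : StrongDual ℝ (DirectProd ρ X)) (x : DirectProd ρ X) :
    f x = ∑ n, component n f (x n) := by
  have hx : x = ∑ n, single ρ X n (x n) :=
    (Finset.univ_sum_single (M := X) x).symm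
  conv_lhs => rw [hx]
  rw [map_sum]
  rfl

theorem ext_component {f g : StrongDual ℝ (DirectProd ρ X)}
    (h : ∀ n, component n f = component n g) : f = g := by
  ext x
  simp only [apply_eq_sum_component, h]

theorem norm_le_dualNorm (f : StrongDual ℝ (DirectProd ρ X)) :
    ‖f‖ ≤ ρ.dualNorm (componentNorms f) := by
  have hbound : ∀ x, ‖f x‖ ≤ ρ.dualNorm (componentNorms f) * ‖x‖ := by
    intro x
    rw [apply_eq_sum_component, norm_def]
    refine (norm_sum_le _ _).trans (le_trans (Finset.sum_le_sum fun n _ => ?_)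
      (ρ.sum_mul_le (componentNorms f) fun n => ‖x n‖))
    exact (component n f).le_opNorm (x n)
  refine f.opNorm_le_bound ?_ hbound
  have := ρ.sum_mul_le_dualNorm (componentNorms f) (z := 0) (by rw [map_zero]; exact zero_le_one)
  simpa using this

/-- Component norms need not be attained, so unit vectors that are maximizing up to `δ` are glued
with weights `|z n|`; the total error is `δ * ∑ |z n| ≤ ε`. -/
theorem norm_eq_dualNorm (f : StrongDual ℝ (DirectProd ρ X)) :
    ‖f‖ = ρ.dualNorm (componentNorms f) := by
  refine le_antisymm (norm_le_dualNorm f) (ρ.dualNorm_le fun z hz => ?_)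
  refine le_of_forall_pos_le_add fun ε hε => ?_
  have hA : 0 < ∑ n, |z n| + 1 := by positivity
  set δ := ε / (∑ n, |z n| + 1) with hδ
  have hδ0 : 0 < δ := div_pos hε hA
  have hx : ∀ n, ∃ x : X n, ‖x‖ ≤ 1 ∧ ‖component n f‖ - δ ≤ component n f x := by
    intro n
    by_contra hcon
    push Not at hcon
    have h0 : 0 ≤ ‖component n f‖ - δ := by simpa using (hcon 0 (by simp)).le
    have hle : ‖component n f‖ ≤ ‖component n f‖ - δ := by
      refine (component n f).opNorm_le_of_unit_norm h0 fun x hx => ?_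
      rw [Real.norm_eq_abs, abs_le]
      constructor
      · have := hcon (-x) (by rw [norm_neg, hx])
        rw [map_neg] at this
        linarith
      · exact (hcon x hx.le).le
    linarith
  choose x hx1 hxf using hx
  let w : DirectProd ρ X := fun n => |z n| • x n
  have hw : ‖w‖ ≤ 1 := by
    rw [norm_def]
    refine (ρ.mono _ z fun n => ?_).trans hz
    rw [abs_norm]
    change ‖|z n| • x n‖ ≤ |z n|
    rw [norm_smul, Real.norm_eq_abs, abs_abs]
    exact mul_le_of_le_one_right (abs_nonneg _) (hx1 n)
  have hfw : f w ≤ ‖f‖ :=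
    (le_abs_self _).trans ((f.le_opNorm w).trans (mul_le_of_le_one_right (norm_nonneg _) hw))
  have hsum : ∑ n, componentNorms f n * z n ≤ f w + δ * ∑ n, |z n| := by
    rw [apply_eq_sum_component, Finset.mul_sum, ← Finset.sum_add_distrib]
    refine Finset.sum_le_sum fun n _ => ?_
    change ‖component n f‖ * z n ≤ component n f (|z n| • x n) + δ * |z n|
    rw [map_smul, smul_eq_mul]
    have h1 : ‖component n f‖ * z n ≤ ‖component n f‖ * |z n| :=
      mul_le_mul_of_nonneg_left (le_abs_self _) (norm_nonneg _)
    have h2 := mul_le_mul_of_nonneg_left (hxf n) (abs_nonneg (z n))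
    linarith
  have hδε : δ * ∑ n, |z n| ≤ ε := by
    rw [hδ, div_mul_eq_mul_div, div_le_iff₀ hA]
    nlinarith
  linarith

/-- The projection to the `n`-th factor. -/
noncomputable def proj (ρ : AbsoluteNorm N) (X : Fin N → Type*)
    [∀ n, NormedAddCommGroup (X n)] [∀ n, NormedSpace ℝ (X n)] (n : Fin N) :
    DirectProd ρ X →L[ℝ] X n :=
  LinearMap.mkContinuous
    { toFun := fun x => x n
      map_add' := fun _ _ => rfl
      map_smul' := fun _ _ => rfl }
    (ρ (Pi.single n 1))⁻¹ (fun x => by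
      have h := ρ.abs_apply_le (fun k => ‖x k‖) n
      rw [abs_norm, div_eq_inv_mul] at h
      exact h)

/-- The functional with given components. -/
noncomputable def ofComponents (ρ : AbsoluteNorm N) (g : ∀ n, StrongDual ℝ (X n)) :
    StrongDual ℝ (DirectProd ρ X) :=
  ∑ n, (g n).comp (proj ρ X n)

theorem component_ofComponents (g : ∀ n, StrongDual ℝ (X n)) (n : Fin N) :
    component n (ofComponents ρ g) = g n := by
  ext x
  change (ofComponents ρ g) (single ρ X n x) = g n x
  rw [ofComponents, sum_apply, Finset.sum_eq_single n]
  · change g n ((Pi.single n x : ∀ k, X k) n) = g n x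
    rw [Pi.single_eq_same]
  · intro k _ hk
    change g k ((Pi.single n x : ∀ k, X k) k) = 0
    rw [Pi.single_eq_of_ne hk, map_zero]
  · simp

theorem bijective_component :
    Function.Bijective
      (fun (f : StrongDual ℝ (DirectProd ρ X)) (n : Fin N) => component n f) :=
  ⟨fun _ _ h => ext_component (congrFun h),
    fun g => ⟨ofComponents ρ g, funext (component_ofComponents g)⟩⟩

/-! ### Extreme points of the dual unit ball of a direct product -/

/-- The nonzero components of an atom are multiples of atoms. -/
theorem inv_norm_smul_component_mem_dualAtoms {e : StrongDual ℝ (DirectProd ρ X)}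
    (he : e ∈ dualAtoms (DirectProd ρ X)) {n : Fin N} (hn : component n e ≠ 0) :
    ‖component n e‖⁻¹ • component n e ∈ dualAtoms (X n) := by
  classical
  obtain ⟨hmem, hext⟩ := mem_extremePoints_iff_left.1 he
  rw [mem_closedBall_zero_iff] at hmem
  set s := ‖component n e‖ with hs
  have hs0 : 0 < s := norm_pos_iff.2 hn
  -- Replacing the `n`-th component by one of norm at most `s` stays in the unit ball by
  -- monotonicity, so a splitting of the normalized component lifts to one of `e`.
  let G : StrongDual ℝ (X n) → StrongDual ℝ (DirectProd ρ X) := fun h =>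
    ofComponents ρ (Function.update (fun k => component k e) n h)
  have hG : ∀ h k, component k (G h) = Function.update (fun k => component k e) n h k :=
    fun h k => component_ofComponents _ k
  have hball : ∀ x ∈ Metric.closedBall (0 : StrongDual ℝ (X n)) 1,
      G (s • x) ∈ Metric.closedBall (0 : StrongDual ℝ (DirectProd ρ X)) 1 := by
    intro x hx
    rw [mem_closedBall_zero_iff] at hx ⊢
    refine le_trans ?_ hmem
    rw [norm_eq_dualNorm, norm_eq_dualNorm]
    refine ρ.dualNorm_mono fun k => ?_
    rw [componentNorms, abs_norm, hG]
    rcases eq_or_ne k n with rfl | hk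
    · rw [Function.update_self, norm_smul, Real.norm_of_nonneg hs0.le]
      exact mul_le_of_le_one_right hs0.le hx
    · rw [Function.update_of_ne hk]; exact le_rfl
  refine mem_extremePoints_iff_left.2 ⟨?_, ?_⟩
  · rw [mem_closedBall_zero_iff, norm_smul, norm_inv, norm_norm, inv_mul_cancel₀ hs0.ne']
  · rintro x₁ h₁ x₂ h₂ ⟨a, b, ha, hb, hab, h⟩
    have h3 : G (s • x₁) = e := by
      refine hext _ (hball _ h₁) _ (hball _ h₂) ⟨a, b, ha, hb, hab, ext_component fun k => ?_⟩
      rw [component_add, component_smul, component_smul, hG, hG]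
      rcases eq_or_ne k n with rfl | hk
      · rw [Function.update_self, Function.update_self, smul_comm a, smul_comm b, ← smul_add, h,
          smul_smul, mul_inv_cancel₀ hs0.ne', one_smul]
      · rw [Function.update_of_ne hk, Function.update_of_ne hk, ← add_smul, hab, one_smul]
    have h4 : component n e = s • x₁ := by
      rw [← h3, hG, Function.update_self]
    rw [h4, smul_smul, inv_mul_cancel₀ hs0.ne', one_smul]

/-- For the `ℓ¹` outer norm an atom has at most one nonzero component. -/
theorem eq_of_component_ne_zero (hρ : ρ.DualIsL1) {e : StrongDual ℝ (DirectProd ρ X)}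
    (he : e ∈ dualAtoms (DirectProd ρ X)) {n k : Fin N} (hn : component n e ≠ 0)
    (hk : component k e ≠ 0) : n = k := by
  classical
  by_contra hnk
  obtain ⟨hmem, hext⟩ := mem_extremePoints_iff_left.1 he
  rw [mem_closedBall_zero_iff] at hmem
  have hn0 : 0 < ‖component n e‖ := norm_pos_iff.2 hn
  have hk0 : 0 < ‖component k e‖ := norm_pos_iff.2 hk
  set s := min ‖component n e‖ ‖component k e‖ with hs
  have hs0 : 0 < s := lt_min hn0 hk0
  -- These factors transfer norm `σ` from component `k` to component `n`. The `ℓ¹` norm is preserved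
  -- while `|σ| ≤ s`, and `e` is the midpoint of the transfers by `s` and `-s`.
  let c : ℝ → Fin N → ℝ := fun σ j =>
    1 + (if j = n then σ / ‖component n e‖ else 0) - (if j = k then σ / ‖component k e‖ else 0)
  let G : ℝ → StrongDual ℝ (DirectProd ρ X) := fun σ =>
    ofComponents ρ fun j => c σ j • component j e
  have hG : ∀ σ j, component j (G σ) = c σ j • component j e :=
    fun σ j => component_ofComponents _ j
  have hc : ∀ σ, |σ| ≤ s → ∀ j, 0 ≤ c σ j := by
    intro σ hσ j
    have h1 : |σ / ‖component n e‖| ≤ 1 := by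
      rw [abs_div, abs_norm]
      exact div_le_one_of_le₀ (hσ.trans (min_le_left _ _)) hn0.le
    have h2 : |σ / ‖component k e‖| ≤ 1 := by
      rw [abs_div, abs_norm]
      exact div_le_one_of_le₀ (hσ.trans (min_le_right _ _)) hk0.le
    rw [abs_le] at h1 h2
    simp only [c]
    rcases eq_or_ne j n with rfl | hj
    · rw [if_pos rfl, if_neg hnk]; linarith
    · rw [if_neg hj]
      split_ifs <;> linarith
  have hball : ∀ σ, |σ| ≤ s → G σ ∈ Metric.closedBall (0 : StrongDual ℝ (DirectProd ρ X)) 1 := by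
    intro σ hσ
    rw [mem_closedBall_zero_iff]
    refine le_trans (le_of_eq ?_) hmem
    rw [norm_eq_dualNorm, norm_eq_dualNorm, hρ, hρ]
    have : ∀ j, |componentNorms (G σ) j| = |componentNorms e j| +
        (if j = n then σ else 0) - (if j = k then σ else 0) := by
      intro j
      have h1 : |componentNorms (G σ) j| = c σ j * ‖component j e‖ := by
        rw [componentNorms, abs_norm, hG, norm_smul, Real.norm_of_nonneg (hc σ hσ j)]
      have h2 : |componentNorms e j| = ‖component j e‖ := abs_norm _
      rw [h1, h2]
      simp only [c]
      rcases eq_or_ne j n with rfl | hj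
      · rw [if_pos rfl, if_pos rfl, if_neg hnk, if_neg hnk]
        field_simp
        ring
      · rw [if_neg hj, if_neg hj]
        split_ifs with hjk
        · subst hjk
          field_simp
          ring
        · ring
    simp only [this, Finset.sum_sub_distrib, Finset.sum_add_distrib, Finset.sum_ite_eq',
      Finset.mem_univ, if_true]
    ring
  have hmid : e ∈ openSegment ℝ (G s) (G (-s)) := by
    refine ⟨1 / 2, 1 / 2, by norm_num, by norm_num, by norm_num, ext_component fun j => ?_⟩
    rw [component_add, component_smul, component_smul, hG, hG, smul_smul, smul_smul, ← add_smul]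
    have : 1 / 2 * c s j + 1 / 2 * c (-s) j = 1 := by
      simp only [c]
      split_ifs <;> ring
    rw [this, one_smul]
  have hs1 : |s| ≤ s := (abs_of_pos hs0).le
  have h := hext _ (hball s hs1) _ (hball (-s) (by rwa [abs_neg])) hmid
  have h2 := hG s n
  rw [h] at h2
  have h3 : c s n = 1 := by
    have h4 := congrArg norm h2
    rw [norm_smul, Real.norm_of_nonneg (hc s hs1 n)] at h4
    exact mul_right_cancel₀ hn0.ne' (by rw [one_mul]; exact h4.symm)
  simp only [c, if_true, if_neg hnk] at h3
  have h5 : 0 < s / ‖component n e‖ := div_pos hs0 hn0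
  linarith

end DirectProd

/-! ### Weak* topology -/

section WeakStar

variable {X : Type*} [NormedAddCommGroup X] [NormedSpace ℝ X]

theorem locallyConvexSpace_weakDual : LocallyConvexSpace ℝ (WeakDual ℝ X) :=
  (WeakDual.withSeminorms ℝ X).toLocallyConvexSpace

theorem extremePoints_weakStar (A : Set (StrongDual ℝ X)) :
    Set.extremePoints ℝ (weakStar A) = weakStar (Set.extremePoints ℝ A) :=
  (image_extremePoints (𝕜 := ℝ) (StrongDual.toWeakDual (𝕜 := ℝ) (E := X)) A).symm

theorem convex_weakStar {A : Set (StrongDual ℝ X)} (hA : Convex ℝ A) : Convex ℝ (weakStar A) :=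
  hA.linear_image (StrongDual.toWeakDual (𝕜 := ℝ) (E := X)).toLinearMap

theorem mem_weakStar {A : Set (StrongDual ℝ X)} {f : WeakDual ℝ X} :
    f ∈ weakStar A ↔ WeakDual.toStrongDual f ∈ A := by
  constructor
  · rintro ⟨g, hg, rfl⟩
    exact hg
  · exact fun h => ⟨WeakDual.toStrongDual f, h, rfl⟩

theorem isCompact_weakStar_interpolants {M : ℕ} (ν : Fin M → X) (z : Fin M → ℝ) (r : ℝ) :
    IsCompact (weakStar {f : StrongDual ℝ X | (∀ m, f (ν m) = z m) ∧ ‖f‖ ≤ r}) := by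
  have hclosed : IsClosed {f : WeakDual ℝ X | ∀ m, f (ν m) = z m} := by
    simp only [Set.ofPred_forall]
    exact isClosed_iInter fun m =>
      isClosed_eq (WeakDual.eval_continuous (ν m)) continuous_const
  convert (WeakDual.isCompact_closedBall (𝕜 := ℝ) (0 : StrongDual ℝ X) r).inter_right hclosed
    using 1
  ext f
  rw [mem_weakStar]
  constructor
  · rintro ⟨h1, h2⟩
    exact ⟨mem_closedBall_zero_iff.2 h2, h1⟩
  · rintro ⟨h1, h2⟩
    exact ⟨h2, mem_closedBall_zero_iff.1 h1⟩

/-- **Krein–Milman** in a dual space with its weak* topology. -/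
theorem weakStar_eq_closure_convexHull {A : Set (StrongDual ℝ X)} (hA : Convex ℝ A)
    (hc : IsCompact (weakStar A)) :
    weakStar A = closure (convexHull ℝ (weakStar (Set.extremePoints ℝ A))) := by
  have := locallyConvexSpace_weakDual (X := X)
  rw [← extremePoints_weakStar, closure_convexHull_extremePoints hc (convex_weakStar hA)]

/-- Supplies an atom to carry a zero coefficient where a component vanishes. -/
theorem dualAtoms_nonempty : (dualAtoms X).Nonempty := by
  have := locallyConvexSpace_weakDual (X := X)
  have hc : IsCompact (weakStar (Metric.closedBall (0 : StrongDual ℝ X) 1)) := by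
    convert WeakDual.isCompact_closedBall (𝕜 := ℝ) (0 : StrongDual ℝ X) 1 using 1
    ext f
    exact mem_weakStar
  obtain ⟨f, hf⟩ := hc.extremePoints_nonempty ⟨0, mem_weakStar.2 (by simp)⟩
  rw [extremePoints_weakStar] at hf
  exact ⟨_, mem_weakStar.1 hf⟩

end WeakStar

theorem convex_interpolants {M : ℕ} {X : Type*} [NormedAddCommGroup X] [NormedSpace ℝ X]
    (ν : Fin M → X) (z : Fin M → ℝ) (r : ℝ) :
    Convex ℝ {f : StrongDual ℝ X | (∀ m, f (ν m) = z m) ∧ ‖f‖ ≤ r} := by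
  rintro g ⟨hg, hg'⟩ h ⟨hh, hh'⟩ s t hs ht hst
  refine ⟨fun m => ?_, ?_⟩
  · simp only [add_apply, smul_apply, hg, hh, smul_eq_mul]
    rw [← add_mul, hst, one_mul]
  · exact mem_closedBall_zero_iff.1 (convex_closedBall (0 : StrongDual ℝ X) r
      (mem_closedBall_zero_iff.2 hg') (mem_closedBall_zero_iff.2 hh') hs ht hst)

/-! ### Weak* continuity of the component maps, and conjugacy and atoms by components. -/

namespace DirectProd

variable {N : ℕ} {ρ : AbsoluteNorm N} {X : Fin N → Type*}
  [∀ n, NormedAddCommGroup (X n)] [∀ n, NormedSpace ℝ (X n)]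

/-- The `n`-th component as a weak*-continuous linear map. -/
noncomputable def weakComponent (ρ : AbsoluteNorm N) (X : Fin N → Type*)
    [∀ n, NormedAddCommGroup (X n)] [∀ n, NormedSpace ℝ (X n)] (n : Fin N) :
    WeakDual ℝ (DirectProd ρ X) →L[ℝ] WeakDual ℝ (X n) where
  toFun f := StrongDual.toWeakDual (component n (WeakDual.toStrongDual f))
  map_add' _ _ := rfl
  map_smul' _ _ := rfl
  cont := WeakDual.continuous_of_continuous_eval fun x =>
    WeakDual.eval_continuous (single ρ X n x)

theorem weakStar_component_image (n : Fin N) (S : Set (StrongDual ℝ (DirectProd ρ X))) :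
    weakStar (component n '' S) = weakComponent ρ X n '' weakStar S := by
  rw [weakStar, weakStar, Set.image_image, Set.image_image]
  rfl

theorem isCompact_weakStar_component_image (n : Fin N) {S : Set (StrongDual ℝ (DirectProd ρ X))}
    (hS : IsCompact (weakStar S)) : IsCompact (weakStar (component n '' S)) := by
  rw [weakStar_component_image]
  exact hS.image (weakComponent ρ X n).continuous

theorem convex_component_image (n : Fin N) {S : Set (StrongDual ℝ (DirectProd ρ X))}
    (hS : Convex ℝ S) : Convex ℝ (component n '' S) :=
  hS.linear_image (componentLinear ρ X n)

/-- The fibre of a continuous linear map over an extreme point of the image is a compact face of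
`S`, and its extreme points are extreme in `S`. -/
theorem extremePoints_component_image_subset (n : Fin N)
    {S : Set (StrongDual ℝ (DirectProd ρ X))} (hS : IsCompact (weakStar S)) :
    Set.extremePoints ℝ (component n '' S) ⊆ component n '' Set.extremePoints ℝ S := by
  have := locallyConvexSpace_weakDual (X := DirectProd ρ X)
  intro g hg
  have h := surjOn_extremePoints_image (weakComponent ρ X n).toContinuousAffineMap hS
  have hg' : StrongDual.toWeakDual g ∈
      Set.extremePoints ℝ ((weakComponent ρ X n).toContinuousAffineMap '' weakStar S) := by
    change _ ∈ Set.extremePoints ℝ (weakComponent ρ X n '' weakStar S)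
    rw [← weakStar_component_image, extremePoints_weakStar]
    exact ⟨g, hg, rfl⟩
  obtain ⟨f, hf, hfg⟩ := h hg'
  rw [extremePoints_weakStar] at hf
  exact ⟨_, mem_weakStar.1 hf, StrongDual.toWeakDual.injective hfg⟩

/-! ### Conjugates in a direct product -/

theorem sum_smul_apply {M : ℕ} (a : Fin M → ℝ) (ν : Fin M → DirectProd ρ X) (n : Fin N) :
    (∑ m, a m • ν m) n = ∑ m, a m • ν m n := by
  change proj ρ X n (∑ m, a m • ν m) = ∑ m, a m • proj ρ X n (ν m)
  simp

/-- Both inequalities in `∑ ⟨f_n, x_n⟩ ≤ ∑ ‖f_n‖ ‖x_n‖ ≤ ‖f‖ ‖x‖` are equalities, and a sum of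
termwise inequalities is tight only if each term is. -/
theorem conjugate_component {f : StrongDual ℝ (DirectProd ρ X)} {x : DirectProd ρ X}
    (h : f ∈ dualityMap x) :
    (fun n => ‖x n‖) ∈ ρ.dualDualityMap (componentNorms f) ∧
      ∀ n, component n f (x n) = ‖component n f‖ * ‖x n‖ := by
  obtain ⟨hn, hfx⟩ := h
  have hle : ∀ n ∈ Finset.univ, component n f (x n) ≤ ‖component n f‖ * ‖x n‖ := fun n _ =>
    (le_abs_self _).trans ((component n f).le_opNorm (x n))
  have hsum : ∑ n, ‖component n f‖ * ‖x n‖ ≤ ‖f‖ * ‖x‖ := by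
    rw [norm_eq_dualNorm, norm_def]
    exact ρ.sum_mul_le (componentNorms f) fun n => ‖x n‖
  have hfx' : ∑ n, component n f (x n) = ‖f‖ * ‖x‖ := by
    rw [← apply_eq_sum_component, hfx, mul_comm]
  have heq : ∑ n, component n f (x n) = ∑ n, ‖component n f‖ * ‖x n‖ :=
    le_antisymm (Finset.sum_le_sum hle) (hsum.trans_eq hfx'.symm)
  refine ⟨⟨?_, ?_⟩, fun n => (Finset.sum_eq_sum_iff_of_le hle).1 heq n (Finset.mem_univ n)⟩
  · rw [← norm_eq_dualNorm, hn, norm_def]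
  · rw [← norm_eq_dualNorm, ← norm_def, ← hfx', heq]
    rfl

/-- Rescaled to norm `‖x n‖`, a nonzero component is a conjugate of `x n`; `hx` ensures that the
rescaling is invertible. -/
theorem component_eq_scaling_smul {f : StrongDual ℝ (DirectProd ρ X)} {x : DirectProd ρ X}
    (h : f ∈ dualityMap x) {n : Fin N} (hx : componentNorms f n ≠ 0 → ‖x n‖ ≠ 0)
    {J : X n → StrongDual ℝ (X n)} (hJ : IsDualityOperator J) :
    component n f = scaling (componentNorms f) (fun n => ‖x n‖) n • J (x n) := by
  unfold scaling
  split_ifs with h0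
  · rw [zero_smul]
    exact norm_eq_zero.1 h0
  · have hx0 := hx h0
    have h0' : ‖component n f‖ ≠ 0 := h0
    have hmem : (‖x n‖ / ‖component n f‖) • component n f ∈ dualityMap (x n) := by
      have hnorm : ‖(‖x n‖ / ‖component n f‖) • component n f‖ = ‖x n‖ := by
        rw [norm_smul, Real.norm_of_nonneg (by positivity), div_mul_cancel₀ _ h0']
      refine ⟨hnorm, ?_⟩
      rw [hnorm, smul_apply, (conjugate_component h).2 n, smul_eq_mul]
      field_simp
    rw [hJ (x n), Set.mem_singleton_iff] at hmem
    rw [← hmem, smul_smul]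
    change _ = (‖component n f‖ / ‖x n‖ * (‖x n‖ / ‖component n f‖)) • _
    rw [div_mul_div_cancel₀ hx0, div_self h0', one_smul]

/-! ### Atomic decompositions of components -/

theorem isAtomicSum_component {K : ℕ} {f : StrongDual ℝ (DirectProd ρ X)} (hf : IsAtomicSum K f)
    (n : Fin N) : IsAtomicSum K (component n f) := by
  obtain ⟨c, e, he, rfl⟩ := hf
  have key : ∀ k, ∃ (b : ℝ) (g : StrongDual ℝ (X n)), g ∈ dualAtoms (X n) ∧
      component n (e k) = b • g := by
    intro k
    by_cases h : component n (e k) = 0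
    · obtain ⟨g, hg⟩ := dualAtoms_nonempty (X := X n)
      exact ⟨0, g, hg, by rw [h, zero_smul]⟩
    · refine ⟨‖component n (e k)‖, _, inv_norm_smul_component_mem_dualAtoms (he k) h, ?_⟩
      rw [smul_smul, mul_inv_cancel₀ (norm_ne_zero_iff.2 h), one_smul]
  choose b g hg hb using key
  refine ⟨fun k => c k * b k, g, hg, ?_⟩
  rw [component_sum_smul]
  exact Finset.sum_congr rfl fun k _ => by rw [hb, smul_smul]

/-- Each atom is charged to its only nonzero component, so the sets `A n` are disjoint. A nonzero
strictly convex component has at least one atom charged to it, which pays for the single term `f_n /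
‖f_n‖`, extreme because the whole unit sphere is. -/
theorem exists_atomicSum_components_of_dualIsL1 (hρ : ρ.DualIsL1) {L : ℕ}
    {f : StrongDual ℝ (DirectProd ρ X)} (hf : IsAtomicSum L f) :
    ∃ (K : Fin N → ℕ) (c : ∀ n, Fin (K n) → ℝ) (e : ∀ n, Fin (K n) → StrongDual ℝ (X n)),
      ∑ n, K n ≤ L ∧
      ∀ n, (∀ k, e n k ∈ dualAtoms (X n)) ∧
        component n f = ∑ k, c n k • e n k ∧
        (StrictConvexSpace ℝ (StrongDual ℝ (X n)) → component n f ≠ 0 →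
          K n = 1 ∧ ∀ k, c n k = ‖component n f‖ ∧
            e n k = ‖component n f‖⁻¹ • component n f) := by
  classical
  obtain ⟨b, a, ha, hfa⟩ := hf
  let A : Fin N → Finset (Fin L) := fun n => Finset.univ.filter fun k => component n (a k) ≠ 0
  have hcomp : ∀ n, component n f = ∑ k ∈ A n, b k • component n (a k) := by
    intro n
    rw [hfa, component_sum_smul]
    refine (Finset.sum_subset (Finset.subset_univ _) fun k _ hk => ?_).symm
    have : component n (a k) = 0 := by simpa [A] using hk
    rw [this, smul_zero]
  have hcard : ∑ n, (A n).card ≤ L := by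
    rw [← Finset.card_biUnion]
    · simpa using Finset.card_le_univ (Finset.univ.biUnion A)
    · intro n _ k _ hnk
      refine Finset.disjoint_left.2 fun i hi hi' => hnk ?_
      simp only [A, Finset.mem_filter_univ] at hi hi'
      exact eq_of_component_ne_zero hρ (ha i) hi hi'
  have key : ∀ n, ∃ (K : ℕ) (c : Fin K → ℝ) (e : Fin K → StrongDual ℝ (X n)),
      K ≤ (A n).card ∧ (∀ k, e k ∈ dualAtoms (X n)) ∧ component n f = ∑ k, c k • e k ∧
        (StrictConvexSpace ℝ (StrongDual ℝ (X n)) → component n f ≠ 0 →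
          K = 1 ∧ ∀ k, c k = ‖component n f‖ ∧
            e k = ‖component n f‖⁻¹ • component n f) := by
    intro n
    by_cases hn : StrictConvexSpace ℝ (StrongDual ℝ (X n)) ∧ component n f ≠ 0
    · obtain ⟨hsc, h0⟩ := hn
      have hne := norm_ne_zero_iff.2 h0
      refine ⟨1, fun _ => ‖component n f‖, fun _ => ‖component n f‖⁻¹ • component n f, ?_, ?_, ?_,
        fun _ _ => ⟨rfl, fun _ => ⟨rfl, rfl⟩⟩⟩
      · rw [Nat.one_le_iff_ne_zero, Finset.card_ne_zero, Finset.nonempty_iff_ne_empty]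
        intro hA
        exact h0 (by rw [hcomp n, hA, Finset.sum_empty])
      · intro _
        refine StrictConvexSpace.sphere_subset_extremePoints_closedBall
          (0 : StrongDual ℝ (X n)) one_ne_zero ?_
        rw [mem_sphere_zero_iff_norm, norm_smul, norm_inv, norm_norm, inv_mul_cancel₀ hne]
      · rw [Fin.sum_univ_one, smul_smul, mul_inv_cancel₀ hne, one_smul]
    · let σ : Fin (A n).card → Fin L := fun i => ((A n).equivFin.symm i : Fin L)
      have hσ : ∀ i, component n (a (σ i)) ≠ 0 := fun i =>
        (Finset.mem_filter.1 ((A n).equivFin.symm i).2).2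
      refine ⟨(A n).card, fun i => b (σ i) * ‖component n (a (σ i))‖,
        fun i => ‖component n (a (σ i))‖⁻¹ • component n (a (σ i)), le_rfl,
        fun i => inv_norm_smul_component_mem_dualAtoms (ha _) (hσ i), ?_,
        fun h1 h2 => absurd ⟨h1, h2⟩ hn⟩
      rw [hcomp n, ← Finset.sum_coe_sort, ← (A n).equivFin.symm.sum_comp]
      refine Finset.sum_congr rfl fun i _ => ?_
      rw [smul_smul, mul_assoc, mul_inv_cancel₀ (norm_ne_zero_iff.2 (hσ i)), mul_one]
  choose K c e hK h using key
  exact ⟨K, c, e, (Finset.sum_le_sum fun n _ => hK n).trans hcard, h⟩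

end DirectProd

/-! ### Assembly of the theorem. -/

theorem theorem2 {M N : ℕ} (X : Fin N → Type*) [∀ n, NormedAddCommGroup (X n)]
    [∀ n, NormedSpace ℝ (X n)] [∀ n, CompleteSpace (X n)] (ρ : AbsoluteNorm N)
    (ν : Fin M → DirectProd ρ X) (hν : LinearIndependent ℝ ν)
    (E : (Fin M → ℝ) → (Fin M → ℝ) → ℝ≥0∞) (y : Fin M → ℝ)
    (hE_proper : ∃ z, E y z ≠ ∞) (hE_lsc : LowerSemicontinuous (E y))
    (hE_strict : EStrictConvex (E y))
    (ψ : ℝ≥0 → ℝ≥0) (hψ_mono : StrictMono ψ) (hψ_strict : StrictConvexOn ℝ≥0 Set.univ ψ)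
    (S : Set (StrongDual ℝ (DirectProd ρ X))) (hS : S = solutionSet E y ν ψ) :
    -- the dual of `X` is the direct product of the duals with the dual outer norm
    (Function.Bijective
        (fun (f : StrongDual ℝ (DirectProd ρ X)) (n : Fin N) => DirectProd.component n f) ∧
      ∀ f : StrongDual ℝ (DirectProd ρ X), ‖f‖ = ρ.dualNorm (DirectProd.componentNorms f)) ∧
    (S.Nonempty ∧ Convex ℝ S ∧ IsCompact (weakStar S)) ∧
    -- all solutions are conjugates of a common `ν₀ = ∑ a_m ν_m`
    (∃ (a : Fin M → ℝ) (ystar : Fin N → ℝ),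
      (∀ f ∈ S, f ∈ dualityMap (∑ m, a m • ν m)) ∧
      (∀ f ∈ S, ystar ∈ ρ.dualDualityMap (DirectProd.componentNorms f)) ∧
      (ρ.DualStrictConvex ∨ ρ.DualIsL1 →
        (∀ f ∈ S, ∀ n, DirectProd.componentNorms f n ≠ 0 →
          0 < scaling (DirectProd.componentNorms f) ystar n) ∧
        -- Hilbert components
        (∀ n, HasHilbertNorm (StrongDual ℝ (X n)) →
          ∃ R : X n →L[ℝ] StrongDual ℝ (X n), IsRieszMap R ∧ IsDualityOperator R ∧
            ∀ f ∈ S, DirectProd.component n f =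
              scaling (DirectProd.componentNorms f) ystar n • ∑ m, a m • R (ν m n)) ∧
        -- strictly convex components
        (∀ n, StrictConvexSpace ℝ (StrongDual ℝ (X n)) →
          ∃ J : X n → StrongDual ℝ (X n), IsDualityOperator J ∧
            ∀ f ∈ S, DirectProd.component n f =
              scaling (DirectProd.componentNorms f) ystar n • J (∑ m, a m • ν m n)))) ∧
    -- uniqueness of the Hilbert and of the strictly convex components
    (ρ.DualStrictConvex →
      ∀ n, HasHilbertNorm (StrongDual ℝ (X n)) ∨ StrictConvexSpace ℝ (StrongDual ℝ (X n)) →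
        ∃ g, DirectProd.component n '' S = {g}) ∧
    -- general components, in particular those that are not strictly convex
    (∀ n,
      weakStar (DirectProd.component n '' S) =
        closure (convexHull ℝ (weakStar (Set.extremePoints ℝ (DirectProd.component n '' S)))) ∧
      Set.extremePoints ℝ (DirectProd.component n '' S) ⊆
        DirectProd.component n '' Set.extremePoints ℝ S) ∧
    (∀ f ∈ Set.extremePoints ℝ S, ∃ K₀ ≤ M, IsLeast {K | IsAtomicSum K f} K₀ ∧
      ∀ n, IsAtomicSum K₀ (DirectProd.component n f)) ∧
    -- outer `ℓ¹` norm
    (ρ.DualIsL1 → ∀ f ∈ Set.extremePoints ℝ S,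
      ∃ (K : Fin N → ℕ) (c : ∀ n, Fin (K n) → ℝ) (e : ∀ n, Fin (K n) → StrongDual ℝ (X n)),
        ∑ n, K n ≤ M ∧
        ∀ n, (∀ k, e n k ∈ dualAtoms (X n)) ∧
          DirectProd.component n f = ∑ k, c n k • e n k ∧
          (StrictConvexSpace ℝ (StrongDual ℝ (X n)) → DirectProd.component n f ≠ 0 →
            K n = 1 ∧ ∀ k, c n k = ‖DirectProd.component n f‖ ∧
              e n k = ‖DirectProd.component n f‖⁻¹ • DirectProd.component n f)) := by
  obtain ⟨z, a, r, hr, hset, hne, har, haz⟩ :=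
    exists_solutionSet_eq hν hE_proper hE_lsc hE_strict hψ_mono hψ_strict
  rw [← hS] at hset hne
  set x : DirectProd ρ X := ∑ m, a m • ν m with hx
  have hconj : ∀ f ∈ S, f ∈ dualityMap x := by
    intro f hf
    obtain ⟨hfz, hfr⟩ := hset ▸ hf
    have hfx : f x = r * r := by rw [← haz, hx]; simp [hfz]
    have hrf : r = ‖f‖ := by
      refine le_antisymm ?_ hfr
      rcases hr.eq_or_lt with h | h
      · rw [← h]; exact norm_nonneg _
      · refine le_of_mul_le_mul_right ?_ h
        calc r * r = f x := hfx.symm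
          _ ≤ ‖f‖ * ‖x‖ := (le_abs_self _).trans (f.le_opNorm x)
          _ = ‖f‖ * r := by rw [har]
    exact ⟨by rw [har, hrf], by rw [hfx, har, ← hrf]⟩
  have hconvex : Convex ℝ S := hset ▸ convex_interpolants ν z r
  have hcompact : IsCompact (weakStar S) := hset ▸ isCompact_weakStar_interpolants ν z r
  have hystar : ∀ f ∈ S, (fun n => ‖x n‖) ∈ ρ.dualDualityMap (DirectProd.componentNorms f) :=
    fun f hf => (DirectProd.conjugate_component (hconj f hf)).1
  have hnorm : ∀ f ∈ S, ρ.dualNorm (DirectProd.componentNorms f) = r := fun f hf => by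
    rw [← DirectProd.norm_eq_dualNorm, (hconj f hf).1, har]
  have hpair : ∀ f ∈ S, ∑ n, DirectProd.componentNorms f n * ‖x n‖ = r * r := fun f hf => by
    rw [(hystar f hf).2, hnorm f hf, ← DirectProd.norm_def, har]
  have hpos : ρ.DualStrictConvex ∨ ρ.DualIsL1 → ∀ f ∈ S, ∀ n,
      DirectProd.componentNorms f n ≠ 0 → ‖x n‖ ≠ 0 := fun hρ f hf n hn =>
    AbsoluteNorm.ne_zero_of_conjugate hρ (w := fun n => ‖x n‖) (fun k => norm_nonneg _)
      (hnorm f hf) har (hpair f hf) hn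
  have hatomic : ∀ f ∈ Set.extremePoints ℝ S, ∃ K ≤ M, IsAtomicSum K f := fun f hf =>
    exists_isAtomicSum_of_mem_extremePoints hr har haz (hset ▸ hf)
  -- The witness for `y*` is the vector of component norms of `ν₀`, which does not depend on the
  -- solution.
  refine ⟨⟨DirectProd.bijective_component, DirectProd.norm_eq_dualNorm⟩,
    ⟨hne, hconvex, hcompact⟩, ⟨a, fun n => ‖x n‖, hconj, hystar, fun hρ => ⟨?_, ?_, ?_⟩⟩,
    ?_, fun n => ⟨?_, ?_⟩, ?_, ?_⟩
  · intro f hf n hn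
    unfold scaling
    rw [if_neg hn]
    exact div_pos (lt_of_le_of_ne (norm_nonneg _) hn.symm)
      (lt_of_le_of_ne (norm_nonneg _) (hpos hρ f hf n hn).symm)
  · intro n hn
    obtain ⟨R, hR, hRJ⟩ := exists_isRieszMap_of_dual_hasHilbertNorm hn
    refine ⟨R, hR, hRJ, fun f hf => ?_⟩
    rw [DirectProd.component_eq_scaling_smul (hconj f hf) (hpos hρ f hf n) hRJ, hx,
      DirectProd.sum_smul_apply, map_sum]
    simp only [map_smul]
  · intro n hn
    obtain ⟨J, hJ⟩ := exists_isDualityOperator (X := X n)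
    refine ⟨J, hJ, fun f hf => ?_⟩
    rw [← DirectProd.sum_smul_apply]
    exact DirectProd.component_eq_scaling_smul (hconj f hf) (hpos hρ f hf n) hJ
  · intro hρ n hn
    have hsc : StrictConvexSpace ℝ (StrongDual ℝ (X n)) :=
      hn.elim HasHilbertNorm.strictConvexSpace id
    obtain ⟨J, hJ⟩ := exists_isDualityOperator (X := X n)
    obtain ⟨f₀, hf₀⟩ := hne
    refine ⟨DirectProd.component n f₀,
      (Set.Nonempty.image _ ⟨f₀, hf₀⟩).subset_singleton_iff.1 ?_⟩
    rintro _ ⟨f, hf, rfl⟩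
    -- All solutions have component norms conjugate to the same `y*`; strict convexity makes these
    -- norms, hence the scalings, coincide. For `r = 0` the only solution is zero.
    have heq : DirectProd.componentNorms f = DirectProd.componentNorms f₀ := by
      rcases hr.eq_or_lt with h | h
      · have hzero : ∀ g ∈ S, g = 0 := fun g hg => by
          rw [← norm_eq_zero, (hconj g hg).1, har, h]
        rw [hzero f hf, hzero f₀ hf₀]
      · exact hρ.eq_of_dualNorm_eq h (hnorm f hf) (hnorm f₀ hf₀) (w := fun n => ‖x n‖) har
          (hpair f hf) (hpair f₀ hf₀)
    rw [Set.mem_singleton_iff,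
      DirectProd.component_eq_scaling_smul (hconj f hf) (hpos (Or.inl hρ) f hf n) hJ,
      DirectProd.component_eq_scaling_smul (hconj f₀ hf₀) (hpos (Or.inl hρ) f₀ hf₀ n) hJ, heq]
  · exact weakStar_eq_closure_convexHull (DirectProd.convex_component_image n hconvex)
      (DirectProd.isCompact_weakStar_component_image n hcompact)
  · exact DirectProd.extremePoints_component_image_subset n hcompact
  · intro f hf
    classical
    obtain ⟨K, hK, hfK⟩ := hatomic f hf
    have hex : ∃ K, IsAtomicSum K f := ⟨K, hfK⟩
    exact ⟨Nat.find hex, (Nat.find_min' hex hfK).trans hK,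
      ⟨Nat.find_spec hex, fun L hL => Nat.find_min' hex hL⟩,
      DirectProd.isAtomicSum_component (Nat.find_spec hex)⟩
  · intro hρ f hf
    obtain ⟨L, hL, hfL⟩ := hatomic f hf
    obtain ⟨K, c, e, hK, h⟩ := DirectProd.exists_atomicSum_components_of_dualIsL1 hρ hfL
    exact ⟨K, c, e, hK.trans hL, h⟩
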